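/- Let $n\ge 2$ and consider the $n\times n\times n$ Rubik's Cube. It has $6n^2$ stickers, and in the solved state the six faces are monochromatic, in six different colours. For a face and an integer $1\le k\le\lfloor n/2\rfloor$, the corresponding slice rotation is the clockwise $90^\circ$ rotation (as seen from that face) of the $k$-th slice counted from that face; it acts as a permutation of the $6n^2$ stickers, and for odd $n$ the middle slices are not rotated. Let $\mathbf G\le \mathbf S_{6n^2}$ be the group generated by all slice rotations; its elements are the valid configurations, i.e. the configurations obtained from the solved state by slice rotations. Call two valid configurations physically identical if they show the same colour at each of the $6n^2$ sticker locations (the cube being kept fixed in space), and let $\mathcal S_{\mathrm{phys}}$ be the set of valid configurations up to this equivalence, i.e. the physically distinct valid configurations. If $n$ is odd, then $$|\mathcal S_{\mathrm{phys}}| = \frac{8!\cdot 3^7\cdot 12!\cdot 2^{10}\cdot (24!)^{\frac{(n-3)(n+1)}{4}}}{(24^6)^{\frac{(n-3)(n-1)}{4}}}.$$ If $n$ is even, then $$|\mathcal S_{\mathrm{phys}}| = \frac{8!\cdot 3^7\cdot (24!)^{\frac{n(n-2)}{4}}}{(24^6)^{\frac{(n-2)^2}{4}}}.$$ -/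

import Mathlib

/-! The `n × n × n` Rubik's cube, its stickers, its slice rotations and its physical configurations.

The three coordinate axes are indexed by `Fin 3` (cyclically, so that `a, a + 1, a + 2` is a
right-handed frame), and the `n` layers perpendicular to an axis are indexed by `Fin n`. -/

namespace RubikCube

/-- One of the six faces of the cube: an axis together with a side of it
(`true` is the side on which the coordinate is largest, `false` the opposite one).
Also used as the set of the six colours: each face of the solved cube has its own colour. -/
abbrev Face : Type := Fin 3 × Bool

/-- A position in the `n × n × n` array of `1 × 1 × 1` pieces. -/
abbrev Cell (n : ℕ) : Type := Fin 3 → Fin n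

/-- The piece at position `p` lies in the outermost layer next to the face `f`. -/
def Cell.OnFace {n : ℕ} (p : Cell n) (f : Face) : Prop :=
  if f.2 = true then (p f.1 : ℕ) + 1 = n else (p f.1 : ℕ) = 0

/-- A sticker location: the exposed `1 × 1` side of a piece `cell` that lies on the face `face`.
There are `6 * n ^ 2` of them. -/
@[ext]
structure Sticker (n : ℕ) : Type where
  cell : Cell n
  face : Face
  onFace : cell.OnFace face

/-- The counterclockwise quarter turn of the whole array about axis `a` (seen from the positive end
of the axis): direction `a + 1` goes to `a + 2`, and `a + 2` goes to the opposite of `a + 1`. -/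
def turnCell {n : ℕ} (a : Fin 3) (p : Cell n) : Cell n := fun b =>
  if b = a then p a else if b = a + 1 then (p (a + 2)).rev else p (a + 1)

/-- The effect of the same quarter turn on the six outward directions. -/
def turnFace (a : Fin 3) (f : Face) : Face :=
  if f.1 = a then f else if f.1 = a + 1 then (a + 2, f.2) else (a + 1, !f.2)

theorem turnCell_onFace {n : ℕ} (a : Fin 3) (p : Cell n) (f : Face) (h : p.OnFace f) :
    (turnCell a p).OnFace (turnFace a f) := by
  obtain ⟨b, s⟩ := f
  have h0 := (p (a + 2)).isLt
  fin_cases a <;> fin_cases b <;> cases s <;>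
    simp_all [Cell.OnFace, turnCell, turnFace, Fin.val_rev] <;> omega

theorem turnCell_four {n : ℕ} (a : Fin 3) (p : Cell n) :
    turnCell a (turnCell a (turnCell a (turnCell a p))) = p := by
  funext b
  fin_cases a <;> fin_cases b <;> simp [turnCell]

theorem turnFace_four (a : Fin 3) (f : Face) :
    turnFace a (turnFace a (turnFace a (turnFace a f))) = f := by
  revert a f
  decide

/-- The quarter turn about axis `a`, counterclockwise seen from the positive end of the axis,
of the single layer number `l` perpendicular to `a`: stickers of pieces in that layer are carried
along, all other stickers stay. -/
def turnLayerFun {n : ℕ} (a : Fin 3) (l : Fin n) (s : Sticker n) : Sticker n :=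
  if s.cell a = l then
    ⟨turnCell a s.cell, turnFace a s.face, turnCell_onFace a s.cell s.face s.onFace⟩
  else s

theorem turnLayerFun_four {n : ℕ} (a : Fin 3) (l : Fin n) (s : Sticker n) :
    turnLayerFun a l (turnLayerFun a l (turnLayerFun a l (turnLayerFun a l s))) = s := by
  have key : ∀ p : Cell n, turnCell a p a = p a := fun p => by simp [turnCell]
  by_cases h : s.cell a = l
  · simp [turnLayerFun, h, key, turnCell_four, turnFace_four]
  · simp [turnLayerFun, h]

/-- `turnLayerFun` as a permutation of the stickers. -/
def turnLayer {n : ℕ} (a : Fin 3) (l : Fin n) : Equiv.Perm (Sticker n) where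
  toFun := turnLayerFun a l
  invFun s := turnLayerFun a l (turnLayerFun a l (turnLayerFun a l s))
  left_inv := turnLayerFun_four a l
  right_inv := turnLayerFun_four a l

/-- Names of the slice rotations: a face and the number `k` of a slice, counted from that face.
Slices are counted from `0` here, so `k = 0, …, ⌊n / 2⌋ - 1`; for odd `n` the middle slices
are not turned. -/
abbrev SliceName (n : ℕ) : Type := Face × Fin (n / 2)

/-- The `k`-th layer counted from the face `f`. -/
def sliceLayer {n : ℕ} (m : SliceName n) : Fin n :=
  let k : Fin n := Fin.castLE (Nat.div_le_self n 2) m.2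
  if m.1.2 = true then k.rev else k

/-- The slice rotation: the quarter turn, clockwise as seen from the face `f`,
of the `k`-th slice counted from `f`. -/
def sliceRotation {n : ℕ} (m : SliceName n) : Equiv.Perm (Sticker n) :=
  if m.1.2 = true then (turnLayer m.1.1 (sliceLayer m))⁻¹ else turnLayer m.1.1 (sliceLayer m)

/-- The group of moves: formal words in the slice rotations and their inverses. -/
abbrev Moves (n : ℕ) : Type := FreeGroup (SliceName n)

/-- The permutation of the stickers that a move induces. -/
def stickerPerm (n : ℕ) : Moves n →* Equiv.Perm (Sticker n) :=
  FreeGroup.lift sliceRotation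

/-- The symmetry group of the cube, that is, the set of valid configurations: the permutations of
the stickers that are obtained from the solved state (the identity) by slice rotations. In the
configuration `g`, the sticker that started at location `s` is at location `g s`. -/
def cubeGroup (n : ℕ) : Subgroup (Equiv.Perm (Sticker n)) :=
  (stickerPerm n).range

/-- The physical appearance of a configuration `g`: the colour that is seen at each location.
The colour of a sticker is the face on which it lies in the solved state. -/
def appearance {n : ℕ} (g : Equiv.Perm (Sticker n)) : Sticker n → Face :=
  fun s => (g⁻¹ s).face

/-- Two valid configurations are physically identical if they show the same colour at each
location. -/
def physSetoid (n : ℕ) : Setoid (cubeGroup n) where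
  r g h := appearance g.1 = appearance h.1
  iseqv := ⟨fun _ => rfl, fun h => h.symm, fun h₁ h₂ => h₁.trans h₂⟩

/-- The space of physically distinct valid configurations. -/
def SPhys (n : ℕ) : Type := Quotient (physSetoid n)

end RubikCube

/-! The number of physically distinct configurations of the `n × n × n` Rubik's cube.

Write `n = m + 2`. The 24 rotations of the cube (`Frame`) act on the stickers, and each sticker is a
rotated copy of one of a few reference stickers (`Sticker.forall_of_representatives`). A layer turn
carries rotated copies of a sticker to rotated copies of the same sticker, by a rule that depends
on the piece only (`turnLayer_of`). So the moves act on the rotations attached to each reference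
piece, and the colours seen in a configuration are read off from that action (`appearance_of`).
A piece with at least two stickers shows its whole action, a centre only shows which of the
rotations carry its sticker to which face, and the midpoints of the faces show nothing. It remains
to see which combinations of actions occur.

* Corners and middle edges are only moved by the outer layers. They are described by pairs of
  elements of generalized symmetric groups (`Monomial`), and the pairs that occur are those of
  trivial total twist, trivial total flip, and equal signs (`reachable_eq`).
* The wings form `m / 2` orbits of 24 pieces. Inner layer turns do not move corners and middle
  edges, they act on a single wing orbit, and there they are odd. With a commutator that is a
  3-cycle, this gives the full symmetric group on each orbit, independently
  (`map_wings_eq_top`).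
* The centres form `m / 2 * ((m + 1) / 2)` orbits of 24 pieces. Commutators that fix all other
  pieces are 3-cycles on one centre orbit, which gives the alternating groups
  (`mem_map_centers_of_even`). For the centres on a middle line, a fifth power of a commutator is
  needed. The parity of a centre permutation is not visible, because four centres have the same
  colour; so each orbit contributes all its `24! / (4!) ^ 6` colourings (`card_colouring`,
  `look_surjective`).

In each case, the step from a 3-cycle to the alternating group is Jordan's theorem together with a
finite check that the conjugates of the 3-cycle under the layer turns act transitively
(`alternatingGroup_le_of_blockStep`). -/

namespace RubikCube

open Equiv
open scoped Pointwise commutatorElement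

/-! ### Rotations, and the action of the moves on rotated copies of a sticker -/

/-- The 24 rotations of the cube. The rotation number `ρ` is encoded by two digits: the quotient
`ρ / 3` is the set (in binary) of the axes of space that receive the negative end of an axis of the
cube, and `ρ % 3` tells the axes apart. The number `0` is the identity. -/
abbrev Frame : Type := Fin 24

namespace Frame

/-- The direction of the unrotated cube that the rotation `ρ` carries to the positive end of
axis `i`, that is, `ρ⁻¹` applied to that end. Rotations preserve orientation, so the axes are
permuted cyclically exactly if an even number of signs are negative; this is the case for the
sign patterns `0, 3, 5, 6`. -/
def dir (ρ : Frame) (i : Fin 3) : Face :=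
  (if ρ.val / 3 ∈ [0, 3, 5, 6] then i + Fin.ofNat 3 ρ.val else 1 - i + Fin.ofNat 3 ρ.val,
    !(ρ.val / 3).testBit i)

/-- The rotation `ρ` followed by the quarter turn of the whole cube about axis `a`. The table is
pinned down by `dir_turnFun`. -/
def turnFun (a : Fin 3) : Frame → Frame :=
  ![![8, 6, 7, 10, 11, 9, 19, 20, 18, 23, 21, 22, 1, 2, 0, 5, 3, 4, 14, 12, 13, 16, 17, 15],
    ![13, 14, 12, 2, 0, 1, 20, 18, 19, 7, 8, 6, 17, 15, 16, 4, 5, 3, 22, 23, 21, 11, 9, 10],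
    ![3, 4, 5, 9, 10, 11, 0, 1, 2, 6, 7, 8, 15, 16, 17, 21, 22, 23, 12, 13, 14, 18, 19, 20]] a

/-- The direction to which the rotation `ρ` carries the direction `f`. -/
def img (ρ : Frame) (f : Face) : Face :=
  if (ρ.dir 0).1 = f.1 then (0, (ρ.dir 0).2 == f.2)
  else if (ρ.dir 1).1 = f.1 then (1, (ρ.dir 1).2 == f.2)
  else (2, (ρ.dir 2).2 == f.2)

theorem dir_turnFun : ∀ (a : Fin 3) (ρ : Frame) (i : Fin 3), (turnFun a ρ).dir i =
    if i = a then ρ.dir a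
    else if i = a + 1 then ((ρ.dir (a + 2)).1, !(ρ.dir (a + 2)).2) else ρ.dir (a + 1) := by
  decide +kernel

theorem turnFun_four : ∀ (a : Fin 3) (ρ : Frame),
    turnFun a (turnFun a (turnFun a (turnFun a ρ))) = ρ := by
  decide +kernel

theorem dir_img : ∀ (ρ : Frame) (f : Face),
    ρ.dir (ρ.img f).1 = (f.1, (ρ.img f).2 == f.2) := by
  decide +kernel

theorem img_turnFun : ∀ (a : Fin 3) (ρ : Frame) (f : Face),
    (turnFun a ρ).img f = turnFace a (ρ.img f) := by
  decide +kernel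

/-- Precomposing with the inverse of the quarter turn about axis `a` gives a rotation again. -/
theorem exists_roll : ∀ (a : Fin 3) (ρ : Frame), ∃ σ : Frame,
    (∀ i, σ.dir i = turnFace a (ρ.dir i)) ∧ ∀ f, σ.img (turnFace a f) = ρ.img f := by
  decide +kernel

theorem dir_zero : ∀ i : Fin 3, dir 0 i = (i, true) := by decide +kernel

theorem img_zero : ∀ f : Face, img 0 f = f := by decide +kernel

theorem img_ext : ∀ ρ σ : Frame, ρ.img (1, true) = σ.img (1, true) →
    ρ.img (2, true) = σ.img (2, true) → ρ = σ := by
  decide +kernel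

end Frame

/-- The effect of a layer turn about axis `a` on the 24 rotated copies of a piece, indexed by
rotations: the copy `ρ` is carried along if the direction that points to the positive end of axis
`a` came from one of the directions in `S`, and it stays otherwise. The turn does not change that
direction, so this is a permutation. -/
def partialTurn (a : Fin 3) (S : Finset Face) : Perm Frame where
  toFun ρ := if ρ.dir a ∈ S then Frame.turnFun a ρ else ρ
  invFun ρ := if ρ.dir a ∈ S then
    Frame.turnFun a (Frame.turnFun a (Frame.turnFun a ρ)) else ρ
  left_inv ρ := by
    by_cases h : ρ.dir a ∈ S <;> simp [h, Frame.dir_turnFun, Frame.turnFun_four]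
  right_inv ρ := by
    by_cases h : ρ.dir a ∈ S <;> simp [h, Frame.dir_turnFun, Frame.turnFun_four]

theorem partialTurn_apply (a : Fin 3) (S : Finset Face) (ρ : Frame) :
    partialTurn a S ρ = if ρ.dir a ∈ S then Frame.turnFun a ρ else ρ := rfl

@[simp] theorem partialTurn_empty (a : Fin 3) : partialTurn a ∅ = 1 := by
  ext ρ; simp [partialTurn_apply]

namespace Cell

variable {n : ℕ}

/-- The coordinate of the position `p` along the direction `f`: it counts layers towards `f`. -/
def level (p : Cell n) (f : Face) : Fin n := if f.2 = true then p f.1 else (p f.1).rev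

/-- The image of the position `p` under the rotation `ρ`. -/
def place (p : Cell n) (ρ : Frame) : Cell n := fun i => p.level (ρ.dir i)

/-- The directions along which the position `p` has the coordinate `l`. -/
def layerFaces (p : Cell n) (l : Fin n) : Finset Face := {f | p.level f = l}

theorem level_not (p : Cell n) (i : Fin 3) (s : Bool) : p.level (i, !s) = (p.level (i, s)).rev := by
  cases s <;> simp [level]

theorem place_turnFun (p : Cell n) (a : Fin 3) (ρ : Frame) :
    p.place (Frame.turnFun a ρ) = turnCell a (p.place ρ) := by
  funext i
  simp only [place, turnCell, Frame.dir_turnFun]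
  split_ifs <;> simp [level_not]

theorem onFace_iff (p : Cell n) (f : Face) : p.OnFace f ↔ (p.level f : ℕ) + 1 = n := by
  have := (p f.1).isLt
  simp only [OnFace, level]
  split_ifs
  · rfl
  · rw [Fin.val_rev]; omega

theorem level_place_img (p : Cell n) (ρ : Frame) (f : Face) :
    (p.place ρ).level (ρ.img f) = p.level f := by
  have := Frame.dir_img ρ f
  obtain ⟨b, s⟩ := f
  generalize ρ.img (b, s) = g at *
  obtain ⟨c, t⟩ := g
  cases s <;> cases t <;> simp_all [level, place]

theorem place_onFace {p : Cell n} {f : Face} (h : p.OnFace f) (ρ : Frame) :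
    (p.place ρ).OnFace (ρ.img f) := by
  rw [onFace_iff] at h ⊢
  rwa [level_place_img]

end Cell

section Equivariance

variable {n : ℕ}

/-- The image under the rotation `ρ` of the sticker of the piece `p` on the face `f`. -/
def Sticker.of (p : Cell n) (f : Face) (h : p.OnFace f) (ρ : Frame) : Sticker n :=
  ⟨p.place ρ, ρ.img f, Cell.place_onFace h ρ⟩

/-- On the rotated copies of a sticker, the turn of the layer `l` about axis `a` acts by
`partialTurn`, whatever the face on which the sticker lies. -/
theorem turnLayer_of (a : Fin 3) (l : Fin n) (p : Cell n) (f : Face) (h : p.OnFace f) (ρ : Frame) :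
    turnLayer a l (Sticker.of p f h ρ) = Sticker.of p f h (partialTurn a (p.layerFaces l) ρ) := by
  change turnLayerFun a l _ = _
  by_cases hl : p.level (ρ.dir a) = l
  · have : ρ.dir a ∈ p.layerFaces l := by simpa [Cell.layerFaces] using hl
    simp only [turnLayerFun, Sticker.of, Cell.place, hl, partialTurn_apply, this, if_true]
    ext1
    · exact (Cell.place_turnFun p a ρ).symm
    · exact (Frame.img_turnFun a ρ f).symm
  · have : ρ.dir a ∉ p.layerFaces l := by simpa [Cell.layerFaces] using hl
    simp only [turnLayerFun, Sticker.of, Cell.place, hl, partialTurn_apply, this, if_false]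

/-- The turn of the layer `l` about axis `a`, as it acts on the copies of each position `p`. -/
def layerTurn (a : Fin 3) (l : Fin n) : Cell n → Perm Frame :=
  fun p => partialTurn a (p.layerFaces l)

/-- The action of the moves on pairs of a position and a rotation. A position is kept as an index,
and the moves permute the rotations that are attached to it. -/
def frameAction (n : ℕ) : Moves n →* (Cell n → Perm Frame) :=
  FreeGroup.lift fun m =>
    if m.1.2 = true then (layerTurn m.1.1 (sliceLayer m))⁻¹ else layerTurn m.1.1 (sliceLayer m)

theorem sliceRotation_of (m : SliceName n) (p : Cell n) (f : Face) (h : p.OnFace f) (ρ : Frame) :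
    sliceRotation m (Sticker.of p f h ρ) =
      Sticker.of p f h (frameAction n (FreeGroup.of m) p ρ) := by
  simp only [sliceRotation, frameAction, FreeGroup.lift_apply_of]
  split_ifs with hs
  · rw [Perm.inv_eq_iff_eq, turnLayer_of]
    simp [layerTurn]
  · exact turnLayer_of ..

theorem stickerPerm_of (w : Moves n) (p : Cell n) (f : Face) (h : p.OnFace f) :
    ∀ ρ : Frame, stickerPerm n w (Sticker.of p f h ρ) =
      Sticker.of p f h (frameAction n w p ρ) := by
  induction w using FreeGroup.induction_on with
  | C1 => intro ρ; simp
  | of m =>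
    intro ρ
    rw [← sliceRotation_of]
    simp [stickerPerm]
  | inv_of m ih =>
    intro ρ
    rw [map_inv, map_inv, Perm.inv_eq_iff_eq, ih]
    simp
  | mul v w hv hw => intro ρ; simp [hv, hw]

/-- The colours seen on the rotated copies of a sticker, in terms of the rotations alone. -/
theorem appearance_of (w : Moves n) (p : Cell n) (f : Face) (h : p.OnFace f) (ρ : Frame) :
    appearance (stickerPerm n w) (Sticker.of p f h ρ) = ((frameAction n w p)⁻¹ ρ).img f := by
  have := stickerPerm_of w⁻¹ p f h ρ
  rw [map_inv, map_inv] at this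
  simp only [appearance, this]
  rfl

/-- The rotated copies of a sticker are also rotated copies of its image under a quarter turn. -/
theorem Sticker.of_turn (a : Fin 3) (p : Cell n) (f : Face) (h : p.OnFace f) (ρ : Frame) :
    ∃ σ, Sticker.of p f h ρ =
      Sticker.of (turnCell a p) (turnFace a f) (turnCell_onFace a p f h) σ := by
  obtain ⟨σ, h1, h2⟩ := Frame.exists_roll a ρ
  refine ⟨σ, ?_⟩
  ext1
  · funext i
    simp only [Sticker.of, Cell.place, h1]
    generalize ρ.dir i = g
    obtain ⟨b, s⟩ := g
    fin_cases a <;> fin_cases b <;> cases s <;> simp [Cell.level, turnCell, turnFace]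
  · exact (h2 f).symm

theorem Sticker.eq_of (s : Sticker n) : s = Sticker.of s.cell s.face s.onFace 0 := by
  ext1
  · funext i
    simp [Sticker.of, Cell.place, Frame.dir_zero, Cell.level]
  · simp [Sticker.of, Frame.img_zero]

end Equivariance

/-! ### Three-cycles and the alternating group -/

section PermGroups

variable {α : Type*}

/-- If `g` normalizes `K`, then `g` permutes the orbits of `K`, so it maps an orbit to itself as
soon as it maps one point of the orbit into the orbit. -/
theorem orbit_closed {K : Subgroup (Perm α)} {g : Perm α}
    (hg : ∀ k ∈ K, g * k * g⁻¹ ∈ K) {x y : α}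
    (hy : y ∈ MulAction.orbit K x) (hgy : g y ∈ MulAction.orbit K x) :
    ∀ z ∈ MulAction.orbit K x, g z ∈ MulAction.orbit K x := by
  intro z hz
  rw [← MulAction.orbit_eq_iff.2 hy] at hz
  obtain ⟨k, rfl⟩ := hz
  rw [← MulAction.orbit_eq_iff.2 hgy]
  exact ⟨⟨g * k * g⁻¹, hg k k.2⟩, by simp [Subgroup.smul_def]⟩

theorem apply_mem_orbit {K : Subgroup (Perm α)} {k : Perm α} (hk : k ∈ K) (x : α) :
    k x ∈ MulAction.orbit K x := ⟨⟨k, hk⟩, rfl⟩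

variable [DecidableEq α]

/-- One pass of a computation of orbits: for each `g` in the list, the set `s` is enlarged by its
image under `g`, provided that `g` maps some point of `s` into `s`. -/
def blockStep (L : List (Perm α)) (s : Finset α) : Finset α :=
  L.foldl (fun s g => if ∃ y ∈ s, g y ∈ s then s ∪ s.image g else s) s

theorem blockStep_subset_orbit {K : Subgroup (Perm α)} {L : List (Perm α)}
    (hL : ∀ g ∈ L, ∀ k ∈ K, g * k * g⁻¹ ∈ K) {x₀ : α} {s : Finset α}
    (hs : ∀ x ∈ s, x ∈ MulAction.orbit K x₀) :
    ∀ x ∈ blockStep L s, x ∈ MulAction.orbit K x₀ := by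
  induction L generalizing s with
  | nil => exact hs
  | cons g L ih =>
    refine ih (fun g' hg' => hL g' (List.mem_cons_of_mem _ hg')) ?_
    dsimp only
    split_ifs with h
    · obtain ⟨y, hy, hgy⟩ := h
      intro x hx
      rcases Finset.mem_union.1 hx with hx | hx
      · exact hs x hx
      · obtain ⟨z, hz, rfl⟩ := Finset.mem_image.1 hx
        exact orbit_closed (hL g List.mem_cons_self) (hs y hy) (hs _ hgy) z (hs z hz)
    · exact hs

variable [Fintype α]

/-- Two points moved by a 3-cycle lie on the same cycle. -/
theorem eq_or_eq_of_isThreeCycle {t : Perm α} (ht : t.IsThreeCycle) {x y : α} (hx : t x ≠ x)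
    (hy : t y ≠ y) : y = x ∨ y = t x ∨ x = t y := by
  obtain ⟨i, hi⟩ := ht.isCycle.exists_pow_eq hx hy
  have h3 : t ^ 3 = 1 := by rw [← ht.orderOf]; exact pow_orderOf_eq_one t
  have : i = 3 * (i / 3) + i % 3 := (Nat.div_add_mod i 3).symm
  rw [this, pow_add, pow_mul, h3, one_pow, one_mul] at hi
  have hlt : i % 3 < 3 := Nat.mod_lt _ (by norm_num)
  interval_cases i % 3
  · exact Or.inl hi.symm
  · exact Or.inr (Or.inl hi.symm)
  · refine Or.inr (Or.inr ?_)
    rw [← hi, ← Perm.mul_apply, ← pow_succ', h3, Perm.one_apply]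

/-- A transitive group generated by 3-cycles contains the alternating group. It is primitive: a
block with two distinct points meets its image under each 3-cycle in `S`, because the 3-cycle
either fixes one of them or moves one to the other; so the block is invariant. Jordan's theorem
then applies. -/
theorem alternatingGroup_le_of_threeCycles {S : Set (Perm α)} (hS : ∀ t ∈ S, t.IsThreeCycle)
    (hne : S.Nonempty) {x₀ : α} (htr : ∀ x, x ∈ MulAction.orbit (Subgroup.closure S) x₀) :
    alternatingGroup α ≤ Subgroup.closure S := by
  obtain ⟨t₀, ht₀⟩ := hne
  have hpre : MulAction.IsPretransitive (Subgroup.closure S) α := by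
    refine ⟨fun x y => ?_⟩
    have := htr y
    rw [← MulAction.orbit_eq_iff.2 (htr x)] at this
    exact this
  refine Perm.alternatingGroup_le_of_isPreprimitive_of_isThreeCycle_mem (g := t₀) ?_ (hS _ ht₀)
    (Subgroup.subset_closure ht₀)
  refine { hpre with isTrivialBlock_of_isBlock := fun {B} hB => ?_ }
  by_cases hsub : B.Subsingleton
  · exact Or.inl hsub
  rw [Set.not_subsingleton_iff] at hsub
  obtain ⟨x, hx, y, hy, hxy⟩ := hsub
  have key : ∀ t ∈ S, ∀ z ∈ B, t z ∈ B := by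
    intro t ht
    have hblock := (MulAction.isBlock_iff_smul_eq_of_mem.1 hB)
      (g := ⟨t, Subgroup.subset_closure ht⟩)
    have hmeet : ∀ z ∈ B, t z ∈ B → ∀ w ∈ B, t w ∈ B := by
      intro z hz htz w hw
      have := hblock hz htz
      rw [← this]
      exact ⟨w, hw, rfl⟩
    by_cases h1 : t x = x
    · exact hmeet x hx (h1.symm ▸ hx)
    by_cases h2 : t y = y
    · exact hmeet y hy (h2.symm ▸ hy)
    rcases eq_or_eq_of_isThreeCycle (hS t ht) h1 h2 with h | h | h
    · exact absurd h.symm hxy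
    · exact hmeet x hx (h ▸ hy)
    · exact hmeet y hy (h ▸ hx)
  have hstab : Subgroup.closure S ≤ MulAction.stabilizer (Perm α) B := by
    rw [Subgroup.closure_le]
    intro t ht
    exact (MulAction.mem_stabilizer_set' B.toFinite).2 fun z hz => key t ht z hz
  refine Or.inr (Set.eq_univ_of_forall fun z => ?_)
  obtain ⟨⟨k, hk⟩, rfl⟩ := MulAction.exists_smul_eq (Subgroup.closure S) x z
  exact (MulAction.mem_stabilizer_set.1 (hstab hk) x).2 hx

/-- A criterion for `K` to contain the alternating group that can be checked by computation. Let
`K` contain a 3-cycle `t` and be normalized by the permutations in `L`. These also normalize the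
subgroup generated by the 3-cycles of `K`; `blockStep L` does not leave the orbit of `x₀` under
that subgroup, so the subgroup is transitive once the iteration exhausts all points. -/
theorem alternatingGroup_le_of_blockStep {K : Subgroup (Perm α)} (L : List (Perm α))
    (hL : ∀ g ∈ L, ∀ k ∈ K, g * k * g⁻¹ ∈ K) {t : Perm α} (htK : t ∈ K)
    (ht : t.support.card = 3) (x₀ : α) (i : ℕ)
    (hi : (blockStep L)^[i] {x₀, t x₀} = Finset.univ) :
    alternatingGroup α ≤ K := by
  rw [card_support_eq_three_iff] at ht
  let S : Set (Perm α) := {s | s ∈ K ∧ s.IsThreeCycle}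
  have hSK : Subgroup.closure S ≤ K := (Subgroup.closure_le K).2 fun s hs => hs.1
  have hconj : ∀ g ∈ L, ∀ k ∈ Subgroup.closure S, g * k * g⁻¹ ∈ Subgroup.closure S := by
    intro g hg k hk
    have : S ⊆ (Subgroup.closure S).comap (MulAut.conj g).toMonoidHom := by
      intro s hs
      refine Subgroup.subset_closure ⟨hL g hg s hs.1, ?_⟩
      have := hs.2
      rw [Perm.IsThreeCycle, MulEquiv.coe_toMonoidHom, MulAut.conj_apply, Perm.cycleType_conj]
      exact this
    exact (Subgroup.closure_le _).2 this hk
  have htS : t ∈ Subgroup.closure S := Subgroup.subset_closure ⟨htK, ht⟩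
  refine (alternatingGroup_le_of_threeCycles (S := S) (fun s hs => hs.2) ⟨t, htK, ht⟩
    (x₀ := x₀) fun x => ?_).trans hSK
  have horb : ∀ j, ∀ x ∈ (blockStep L)^[j] {x₀, t x₀},
      x ∈ MulAction.orbit (Subgroup.closure S) x₀ := by
    intro j
    induction j with
    | zero =>
      intro x hx
      rcases Finset.mem_insert.1 hx with rfl | hx
      · exact MulAction.mem_orbit_self _
      · rw [Finset.mem_singleton.1 hx]
        exact apply_mem_orbit htS x₀
    | succ j ih =>
      rw [Function.iterate_succ_apply']
      exact blockStep_subset_orbit hconj ih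
  exact horb i x (hi ▸ Finset.mem_univ x)

end PermGroups

/-! ### Three-cycles among the layer turns -/

/-- The layer turns as they act on a centre orbit: the outer layers, and the inner layers that
meet the reference centre in the directions `S` and `T`. -/
def centerMoves (S T : Finset Face) : List (Perm Frame) :=
  (List.finRange 3).flatMap fun i => [partialTurn i {(2, true)}, partialTurn i {(2, false)},
    partialTurn i S, partialTurn i T]

/-- The action of a commutator of an inner layer turn with a conjugated inner layer turn on a
centre orbit. It is a 3-cycle since the supports of the two entries share a single point. -/
def centerCycle (S T : Finset Face) : Perm Frame :=
  ⁅partialTurn 0 S, (partialTurn 2 {(2, true)})⁻¹ * partialTurn 0 T * partialTurn 2 {(2, true)}⁆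

theorem centerCycle_single : (centerCycle {(0, true)} {(1, false)}).support.card = 3 ∧
    (blockStep (centerMoves {(0, true)} {(0, false)}))^[4]
      {0, centerCycle {(0, true)} {(1, false)} 0} = Finset.univ := by
  decide +kernel

theorem centerCycle_pair :
    (centerCycle {(0, true), (1, true)} {(0, false), (1, false)}).support.card = 3 ∧
    (blockStep (centerMoves {(0, true), (1, true)} {(0, false), (1, false)}))^[3]
      {0, centerCycle {(0, true), (1, true)} {(0, false), (1, false)} 0} = Finset.univ := by
  decide +kernel

/-- On a centre orbit in a middle line, the commutator of an inner turn with an outer turn is a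
3-cycle. Its fifth power, the inverse 3-cycle, is taken since it is trivial on the wings. -/
theorem midCycle_facts :
    (⁅partialTurn 0 {(0, true)}, partialTurn 2 {(2, true)}⁆ ^ 5).support.card = 3 ∧
    (blockStep (centerMoves {(0, true)} {(0, false)}))^[4]
      {0, (⁅partialTurn 0 {(0, true)}, partialTurn 2 {(2, true)}⁆ ^ 5) 0} = Finset.univ := by
  decide +kernel

/-- On a wing orbit, where the outer turn moves two cycles of four pieces, the same commutator
consists of 5-cycles. -/
theorem midCycle_wing :
    ⁅partialTurn 0 {(0, true)}, partialTurn 2 {(1, true), (2, true)}⁆ ^ 5 = 1 := by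
  decide +kernel

/-- The layer turns as they act on a wing orbit. -/
def wingMoves : List (Perm Frame) :=
  (List.finRange 3).flatMap fun i => [partialTurn i {(1, true), (2, true)},
    partialTurn i {(1, false), (2, false)}, partialTurn i {(0, true)}, partialTurn i {(0, false)}]

/-- The commutator of an inner layer turn with a conjugate of itself by two outer turns, as it acts
on a wing orbit. -/
def wingCycle : Perm Frame :=
  ⁅partialTurn 0 {(0, true)},
    (partialTurn 1 {(1, false), (2, false)} * partialTurn 2 {(1, false), (2, false)}) *
      partialTurn 0 {(0, true)} *
      (partialTurn 1 {(1, false), (2, false)} * partialTurn 2 {(1, false), (2, false)})⁻¹⁆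

theorem wingCycle_facts : wingCycle.support.card = 3 ∧ ∃ x,
    (blockStep wingMoves)^[3] {x, wingCycle x} = Finset.univ := by
  decide +kernel

theorem sign_wing : Perm.sign (partialTurn 0 {(0, true)}) = -1 := by
  decide +kernel

/-! ### Representatives of the stickers up to rotation -/

section Representatives

variable {m : ℕ}

/-- The inner layers below the middle. The cube has `m + 2` layers in each direction, hence `m`
inner ones. -/
def low (j : Fin (m / 2)) : Fin (m + 2) := ⟨j + 1, by omega⟩

/-- The inner layers up to the middle one, which is included if it exists, for odd `m`. -/
def lowMid (k : Fin ((m + 1) / 2)) : Fin (m + 2) := ⟨k + 1, by omega⟩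

/-- The middle layer, for odd `m`. -/
def middle (m : ℕ) : Fin (m + 2) := ⟨(m + 1) / 2, by omega⟩

/-- The reference corner. -/
def cornerCell (m : ℕ) : Cell (m + 2) := ![Fin.last _, Fin.last _, Fin.last _]

/-- The reference edge in a middle layer. For even `m` there is no such piece, and the corner is
taken in its place, so that corners and edges can be treated together for both parities. -/
def edgeCell (m : ℕ) : Cell (m + 2) :=
  ![if Odd m then middle m else Fin.last _, Fin.last _, Fin.last _]

/-- The reference wings: the edge pieces outside the middle layers, up to rotation. Each of their
orbits has 24 pieces, since no rotation but the identity fixes such a piece. -/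
def wingCell (j : Fin (m / 2)) : Cell (m + 2) := ![low j, Fin.last _, Fin.last _]

/-- The reference centres: the pieces inside the faces, up to rotation, but for the midpoints of
the faces. The value `k` of the middle layer gives the centres on the middle lines of a face. -/
def centerCell (j : Fin (m / 2)) (k : Fin ((m + 1) / 2)) : Cell (m + 2) :=
  ![low j, lowMid k, Fin.last _]

/-- The midpoint of a face, for odd `m`. -/
def faceCenterCell (m : ℕ) : Cell (m + 2) := ![middle m, middle m, Fin.last _]

theorem onFace_two (α β : Fin (m + 2)) :
    Cell.OnFace (![α, β, Fin.last _] : Cell (m + 2)) (2, true) := by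
  simp [Cell.OnFace]

theorem onFace_one (α β : Fin (m + 2)) :
    Cell.OnFace (![α, Fin.last _, β] : Cell (m + 2)) (1, true) := by
  simp [Cell.OnFace]

theorem turnCell_zero (α β γ : Fin (m + 2)) : turnCell 0 ![α, β, γ] = ![α, γ.rev, β] := by
  funext i; fin_cases i <;> simp [turnCell]

theorem turnCell_two (α β γ : Fin (m + 2)) : turnCell 2 ![α, β, γ] = ![β.rev, α, γ] := by
  funext i; fin_cases i <;> simp [turnCell]

theorem exists_eq_low {α : Fin (m + 2)} (h0 : 1 ≤ (α : ℕ)) (h1 : 2 * (α : ℕ) < m + 1) :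
    ∃ j, α = low j :=
  ⟨⟨α - 1, by omega⟩, Fin.ext (by simp [low]; omega)⟩

theorem exists_eq_lowMid {α : Fin (m + 2)} (h0 : 1 ≤ (α : ℕ)) (h1 : 2 * (α : ℕ) ≤ m + 1) :
    ∃ k, α = lowMid k :=
  ⟨⟨α - 1, by omega⟩, Fin.ext (by simp [lowMid]; omega)⟩

/-- The coordinates in the top face of the stickers of the reference pieces, where the reference
wings contribute both of their stickers: the second one, after a rotation to the top face, has its
first coordinate above the middle. -/
def IsRep (m a b : ℕ) : Prop :=
  (a = m + 1 ∧ b = m + 1) ∨ (2 * a = m + 1 ∧ b = m + 1) ∨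
    (1 ≤ a ∧ 2 * a < m + 1 ∧ b = m + 1) ∨ (a ≤ m ∧ m + 1 < 2 * a ∧ b = m + 1) ∨
    (1 ≤ a ∧ 2 * a < m + 1 ∧ 1 ≤ b ∧ 2 * b ≤ m + 1) ∨ (2 * a = m + 1 ∧ 2 * b = m + 1)

/-- Each position in the top face is a reference position after 0, 1, 2 or 3 quarter turns of the
face. -/
theorem isRep_rotation {a b a' b' : ℕ} (ha : a + a' = m + 1) (hb : b + b' = m + 1) :
    IsRep m a b ∨ IsRep m b' a ∨ IsRep m a' b' ∨ IsRep m b a' := by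
  have class_ : ∀ c ≤ m + 1, c = 0 ∨ c = m + 1 ∨ (1 ≤ c ∧ 2 * c < m + 1) ∨
      (1 ≤ c ∧ c ≤ m ∧ 2 * c = m + 1) ∨ (c ≤ m ∧ m + 1 < 2 * c) := by omega
  unfold IsRep
  rcases class_ a (by omega) with h | h | h | h | h <;>
    rcases class_ b (by omega) with k | k | k | k | k <;>
      first
      | exact Or.inl (by omega)
      | exact Or.inr (Or.inl (by omega))
      | exact Or.inr (Or.inr (Or.inl (by omega)))
      | exact Or.inr (Or.inr (Or.inr (by omega)))

/-- Each sticker is a rotated copy of a sticker of a reference piece. -/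
theorem Sticker.forall_of_representatives {P : Sticker (m + 2) → Prop}
    (hcorner : ∀ ρ, P (Sticker.of (cornerCell m) (2, true) (onFace_two _ _) ρ))
    (hedge : Odd m → ∀ ρ, P (Sticker.of (edgeCell m) (2, true) (onFace_two _ _) ρ))
    (hwing : ∀ j ρ, P (Sticker.of (wingCell j) (2, true) (onFace_two _ _) ρ))
    (hwing' : ∀ j ρ, P (Sticker.of (wingCell j) (1, true) (onFace_one _ _) ρ))
    (hcenter : ∀ j k ρ, P (Sticker.of (centerCell j k) (2, true) (onFace_two _ _) ρ))
    (hface : Odd m → ∀ ρ, P (Sticker.of (faceCenterCell m) (2, true) (onFace_two _ _) ρ))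
    (s : Sticker (m + 2)) : P s := by
  let Y : Cell (m + 2) → Face → Prop := fun p f => ∀ h ρ, P (Sticker.of p f h ρ)
  have turn : ∀ a p f, Y (turnCell a p) (turnFace a f) → Y p f := by
    intro a p f hY h ρ
    obtain ⟨σ, hσ⟩ := Sticker.of_turn a p f h ρ
    rw [hσ]
    exact hY _ _
  have rot : ∀ α β : Fin (m + 2),
      Y ![β.rev, α, Fin.last _] (2, true) → Y ![α, β, Fin.last _] (2, true) := by
    intro α β hY
    refine turn 2 _ _ ?_
    rw [turnCell_two]
    exact hY
  have base : ∀ α β : Fin (m + 2), IsRep m α β → Y ![α, β, Fin.last _] (2, true) := by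
    intro α β hL
    rcases hL with ⟨h1, h2⟩ | ⟨h1, h2⟩ | ⟨h0, h1, h2⟩ | ⟨h0, h1, h2⟩ | ⟨h0, h1, h2, h3⟩ | ⟨h1, h2⟩
    · obtain rfl : α = Fin.last _ := Fin.ext h1
      obtain rfl : β = Fin.last _ := Fin.ext h2
      exact fun _ => hcorner
    · have hm : Odd m := ⟨(m - 1) / 2, by omega⟩
      obtain rfl : α = middle m := Fin.ext (by simp [middle]; omega)
      obtain rfl : β = Fin.last _ := Fin.ext h2
      have : edgeCell m = ![middle m, Fin.last _, Fin.last _] := by simp [edgeCell, hm]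
      exact this ▸ fun _ => hedge hm
    · obtain ⟨j, rfl⟩ := exists_eq_low h0 h1
      obtain rfl : β = Fin.last _ := Fin.ext h2
      exact fun _ => hwing _
    · obtain rfl : β = Fin.last _ := Fin.ext h2
      obtain ⟨j, rfl⟩ : ∃ j : Fin (m / 2), α = (low j).rev :=
        ⟨⟨m - α, by omega⟩, Fin.ext (by simp [low, Fin.val_rev]; omega)⟩
      refine rot _ _ (rot _ _ (turn 0 _ _ (turn 0 _ _ (turn 0 _ _ ?_))))
      simp only [turnCell_zero, Fin.rev_rev, Fin.rev_last, Fin.rev_zero]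
      exact fun _ => hwing' j
    · obtain ⟨j, rfl⟩ := exists_eq_low h0 h1
      obtain ⟨k, rfl⟩ := exists_eq_lowMid h2 h3
      exact fun _ => hcenter _ _
    · have hm : Odd m := ⟨(m - 1) / 2, by omega⟩
      obtain rfl : α = middle m := Fin.ext (by simp [middle]; omega)
      obtain rfl : β = middle m := Fin.ext (by simp [middle]; omega)
      exact fun _ => hface hm
  have top : ∀ α β : Fin (m + 2), Y ![α, β, Fin.last _] (2, true) := by
    intro α β
    have := isRep_rotation (m := m) (a := α) (b := β) (a' := α.rev) (b' := β.rev)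
      (by rw [Fin.val_rev]; omega) (by rw [Fin.val_rev]; omega)
    rcases this with h | h | h | h
    · exact base _ _ h
    · exact rot _ _ (base _ _ h)
    · exact rot _ _ (rot _ _ (base _ _ h))
    · exact rot _ _ (rot _ _ (rot _ _ (by rw [Fin.rev_rev]; exact base _ _ h)))
  have step : ∀ a f, (∀ q : Cell (m + 2), q.OnFace (turnFace a f) → Y q (turnFace a f)) →
      ∀ p : Cell (m + 2), p.OnFace f → Y p f := fun a f hq p h =>
    turn a p f (hq _ (turnCell_onFace a p f h))
  have z1 : ∀ p : Cell (m + 2), p.OnFace (2, true) → Y p (2, true) := by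
    intro p hp
    have h2 : p 2 = Fin.last _ := Fin.ext (by simpa [Cell.OnFace] using hp)
    have : p = ![p 0, p 1, Fin.last _] := by
      funext i; fin_cases i <;> simp [h2]
    rw [this]
    exact top _ _
  -- Each other face is carried to the top face by at most three quarter turns.
  have x0 := step 1 (0, false) z1
  have z0 := step 1 (2, false) x0
  have x1 := step 1 (0, true) z0
  have y1 := step 0 (1, true) z1
  have y0 := step 0 (1, false) z0
  have all : ∀ (p : Cell (m + 2)) (f : Face), p.OnFace f → Y p f := by
    rintro p ⟨i, t⟩ h
    fin_cases i <;> cases t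
    exacts [x0 p h, x1 p h, y0 p h, y1 p h, z0 p h, z1 p h]
  rw [s.eq_of]
  exact all _ _ s.onFace _ _

end Representatives

/-! ### The group generated by the layer turns -/

section TurnGroup

variable {m : ℕ}

/-- The group generated by the layer turns, acting on the rotated copies of all positions. -/
def turnGroup (m : ℕ) : Subgroup (Cell (m + 2) → Perm Frame) := (frameAction (m + 2)).range

theorem layerTurn_mem {l : Fin (m + 2)} (a : Fin 3) (h : 2 * (l : ℕ) ≠ m + 1) :
    layerTurn a l ∈ turnGroup m := by
  have hl := l.isLt
  by_cases hlt : 2 * (l : ℕ) < m + 1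
  · refine ⟨FreeGroup.of ((a, false), ⟨l, by omega⟩), ?_⟩
    simp [frameAction, sliceLayer]
  · refine ⟨(FreeGroup.of ((a, true), ⟨l.rev, by rw [Fin.val_rev]; omega⟩))⁻¹, ?_⟩
    have : Fin.rev ⟨m + 1 - l, by omega⟩ = l := Fin.ext (by simp only [Fin.val_rev]; omega)
    simp [frameAction, sliceLayer]
    exact congrArg _ this

theorem turnGroup_le {P : Subgroup (Cell (m + 2) → Perm Frame)}
    (h : ∀ (a : Fin 3) (l : Fin (m + 2)), 2 * (l : ℕ) ≠ m + 1 → layerTurn a l ∈ P) :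
    turnGroup m ≤ P := by
  refine FreeGroup.range_lift_le ?_
  rintro _ ⟨⟨⟨a, s⟩, k⟩, rfl⟩
  have hk := k.isLt
  cases s
  · simpa using h a (sliceLayer ((a, false), k)) (by simp [sliceLayer]; omega)
  · simpa using h a (sliceLayer ((a, true), k)) (by simp [sliceLayer, Fin.val_rev]; omega)

theorem low_nonmid (j : Fin (m / 2)) : 2 * (low j : ℕ) ≠ m + 1 := by
  simp only [low]; omega

theorem low_rev_nonmid (j : Fin (m / 2)) : 2 * ((low j).rev : ℕ) ≠ m + 1 := by
  simp only [low, Fin.val_rev]; omega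

theorem last_nonmid : 2 * (Fin.last (m + 1) : ℕ) ≠ m + 1 := by simp

theorem zero_nonmid : 2 * ((0 : Fin (m + 2)) : ℕ) ≠ m + 1 := by simp

theorem mem_layerFaces {n : ℕ} {p : Cell n} {l : Fin n} {f : Face} :
    f ∈ p.layerFaces l ↔ p.level f = l := by
  simp [Cell.layerFaces]

theorem mem_layerFaces_iff_val {n : ℕ} {p : Cell n} {l : Fin n} {f : Face} :
    f ∈ p.layerFaces l ↔ (p.level f : ℕ) = l := by
  rw [mem_layerFaces, Fin.ext_iff]

theorem layerFaces_corner_last :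
    (cornerCell m).layerFaces (Fin.last _) = {(0, true), (1, true), (2, true)} := by
  ext ⟨i, s⟩
  fin_cases i <;> cases s <;> simp [mem_layerFaces_iff_val, Cell.level, cornerCell]

theorem layerFaces_corner_zero :
    (cornerCell m).layerFaces 0 = {(0, false), (1, false), (2, false)} := by
  ext ⟨i, s⟩
  fin_cases i <;> cases s <;> simp [mem_layerFaces_iff_val, Cell.level, cornerCell]

theorem layerFaces_corner_of_ne {l : Fin (m + 2)} (h0 : l ≠ 0) (h1 : l ≠ Fin.last _) :
    (cornerCell m).layerFaces l = ∅ := by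
  ext ⟨i, s⟩
  fin_cases i <;> cases s <;> simp [mem_layerFaces, Cell.level, cornerCell, h0.symm, h1.symm]

theorem edgeCell_of_even (hm : ¬ Odd m) : edgeCell m = cornerCell m := by
  simp [edgeCell, cornerCell, hm]

theorem layerFaces_edge_last (hm : Odd m) :
    (edgeCell m).layerFaces (Fin.last _) = {(1, true), (2, true)} := by
  obtain ⟨r, rfl⟩ := hm
  ext ⟨i, s⟩
  fin_cases i <;> cases s <;>
    simp [mem_layerFaces_iff_val, Cell.level, edgeCell, middle, Fin.val_rev] <;> omega

theorem layerFaces_edge_zero (hm : Odd m) :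
    (edgeCell m).layerFaces 0 = {(1, false), (2, false)} := by
  obtain ⟨r, rfl⟩ := hm
  ext ⟨i, s⟩
  fin_cases i <;> cases s <;>
    simp [mem_layerFaces_iff_val, Cell.level, edgeCell, middle, Fin.val_rev] <;> omega

theorem layerFaces_edge_of_ne {l : Fin (m + 2)} (h0 : l ≠ 0) (h1 : l ≠ Fin.last _)
    (h : 2 * (l : ℕ) ≠ m + 1) : (edgeCell m).layerFaces l = ∅ := by
  by_cases hm : Odd m
  · obtain ⟨r, rfl⟩ := hm
    ext ⟨i, s⟩
    fin_cases i <;> cases s <;>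
      simp [mem_layerFaces, Cell.level, edgeCell, h0.symm, h1.symm] <;>
      simp [middle, Fin.ext_iff, Fin.val_rev] <;> omega
  · rw [edgeCell_of_even hm, layerFaces_corner_of_ne h0 h1]

theorem layerFaces_wing_last (j : Fin (m / 2)) :
    (wingCell j).layerFaces (Fin.last _) = {(1, true), (2, true)} := by
  ext ⟨i, s⟩
  fin_cases i <;> cases s <;>
    simp [mem_layerFaces_iff_val, Cell.level, wingCell, low, Fin.val_rev] <;> omega

theorem layerFaces_wing_zero (j : Fin (m / 2)) :
    (wingCell j).layerFaces 0 = {(1, false), (2, false)} := by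
  ext ⟨i, s⟩
  fin_cases i <;> cases s <;>
    simp [mem_layerFaces_iff_val, Cell.level, wingCell, low, Fin.val_rev] <;> omega

theorem layerFaces_wing_low (j : Fin (m / 2)) :
    (wingCell j).layerFaces (low j) = {(0, true)} := by
  ext ⟨i, s⟩
  fin_cases i <;> cases s <;>
    simp [mem_layerFaces_iff_val, Cell.level, wingCell, low, Fin.val_rev] <;> omega

theorem layerFaces_wing_low_rev (j : Fin (m / 2)) :
    (wingCell j).layerFaces (low j).rev = {(0, false)} := by
  ext ⟨i, s⟩
  fin_cases i <;> cases s <;>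
    simp [mem_layerFaces_iff_val, Cell.level, wingCell, low, Fin.val_rev] <;> omega

theorem layerFaces_wing_low_of_ne {i j : Fin (m / 2)} (h : i ≠ j) :
    (wingCell i).layerFaces (low j) = ∅ := by
  rw [Ne, Fin.ext_iff] at h
  ext ⟨a, s⟩
  fin_cases a <;> cases s <;>
    simp [mem_layerFaces_iff_val, Cell.level, wingCell, low, Fin.val_rev] <;> omega

theorem layerFaces_center_last (j : Fin (m / 2)) (k : Fin ((m + 1) / 2)) :
    (centerCell j k).layerFaces (Fin.last _) = {(2, true)} := by
  ext ⟨i, s⟩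
  fin_cases i <;> cases s <;>
    simp [mem_layerFaces_iff_val, Cell.level, centerCell, low, lowMid, Fin.val_rev] <;> omega

theorem layerFaces_center_zero (j : Fin (m / 2)) (k : Fin ((m + 1) / 2)) :
    (centerCell j k).layerFaces 0 = {(2, false)} := by
  ext ⟨i, s⟩
  fin_cases i <;> cases s <;>
    simp [mem_layerFaces_iff_val, Cell.level, centerCell, low, lowMid, Fin.val_rev] <;> omega

theorem layerFaces_center_low {j : Fin (m / 2)} {k : Fin ((m + 1) / 2)} (h : (k : ℕ) ≠ j) :
    (centerCell j k).layerFaces (low j) = {(0, true)} := by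
  ext ⟨i, s⟩
  fin_cases i <;> cases s <;>
    simp [mem_layerFaces_iff_val, Cell.level, centerCell, low, lowMid, Fin.val_rev] <;> omega

theorem layerFaces_center_low_rev {j : Fin (m / 2)} {k : Fin ((m + 1) / 2)} (h : (k : ℕ) ≠ j) :
    (centerCell j k).layerFaces (low j).rev = {(0, false)} := by
  ext ⟨i, s⟩
  fin_cases i <;> cases s <;>
    simp [mem_layerFaces_iff_val, Cell.level, centerCell, low, lowMid, Fin.val_rev] <;> omega

theorem layerFaces_center_lowMid_rev {j : Fin (m / 2)} {k : Fin ((m + 1) / 2)}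
    (h : (k : ℕ) ≠ j) (hk : 2 * (lowMid k : ℕ) ≠ m + 1) :
    (centerCell j k).layerFaces (lowMid k).rev = {(1, false)} := by
  simp only [lowMid] at hk
  ext ⟨i, s⟩
  fin_cases i <;> cases s <;>
    simp [mem_layerFaces_iff_val, Cell.level, centerCell, low, lowMid, Fin.val_rev] <;> omega

theorem layerFaces_center_diag {j : Fin (m / 2)} {k : Fin ((m + 1) / 2)} (h : (k : ℕ) = j) :
    (centerCell j k).layerFaces (low j) = {(0, true), (1, true)} := by
  ext ⟨i, s⟩
  fin_cases i <;> cases s <;>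
    simp [mem_layerFaces_iff_val, Cell.level, centerCell, low, lowMid, Fin.val_rev] <;> omega

theorem layerFaces_center_diag_rev {j : Fin (m / 2)} {k : Fin ((m + 1) / 2)} (h : (k : ℕ) = j) :
    (centerCell j k).layerFaces (low j).rev = {(0, false), (1, false)} := by
  ext ⟨i, s⟩
  fin_cases i <;> cases s <;>
    simp [mem_layerFaces_iff_val, Cell.level, centerCell, low, lowMid, Fin.val_rev] <;> omega

theorem layerFaces_center_low_of_ne {i j : Fin (m / 2)} {k : Fin ((m + 1) / 2)} (h : i ≠ j)
    (hk : 2 * (lowMid k : ℕ) = m + 1) : (centerCell i k).layerFaces (low j) = ∅ := by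
  rw [Ne, Fin.ext_iff] at h
  simp only [lowMid] at hk
  ext ⟨a, s⟩
  fin_cases a <;> cases s <;>
    simp [mem_layerFaces_iff_val, Cell.level, centerCell, low, lowMid, Fin.val_rev] <;> omega

theorem low_ne_zero (j : Fin (m / 2)) : low j ≠ 0 := by simp [low, Fin.ext_iff]

theorem low_ne_last (j : Fin (m / 2)) : low j ≠ Fin.last _ := by
  simp [low, Fin.ext_iff]; omega

theorem layerTurn_low_corner (a : Fin 3) (j : Fin (m / 2)) :
    layerTurn a (low j) (cornerCell m) = 1 := by
  rw [layerTurn, layerFaces_corner_of_ne (low_ne_zero j) (low_ne_last j), partialTurn_empty]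

theorem layerTurn_low_edge (a : Fin 3) (j : Fin (m / 2)) :
    layerTurn a (low j) (edgeCell m) = 1 := by
  rw [layerTurn, layerFaces_edge_of_ne (low_ne_zero j) (low_ne_last j) (low_nonmid j),
    partialTurn_empty]

/-- The midpoint of a face is only rotated on the spot by the layer turns, because the middle
layers are not turned. -/
theorem img_faceCenter (hm : Odd m) {g : Cell (m + 2) → Perm Frame} (hg : g ∈ turnGroup m)
    (ρ : Frame) : (g (faceCenterCell m) ρ).img (2, true) = ρ.img (2, true) := by
  let P : Subgroup (Cell (m + 2) → Perm Frame) :=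
    { carrier := {g | ∀ ρ, (g (faceCenterCell m) ρ).img (2, true) = ρ.img (2, true)}
      one_mem' := fun ρ => rfl
      mul_mem' := fun {g h} hg hh ρ => (hg _).trans (hh ρ)
      inv_mem' := fun {g} hg ρ => by simpa using (hg ((g (faceCenterCell m))⁻¹ ρ)).symm }
  refine turnGroup_le (P := P) (fun a l hl ρ => ?_) hg ρ
  obtain ⟨r, rfl⟩ := hm
  have hsub : (faceCenterCell (2 * r + 1)).layerFaces l ⊆ {(2, true), (2, false)} := by
    rintro ⟨i, s⟩
    fin_cases i <;> cases s <;>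
      simp [mem_layerFaces_iff_val, Cell.level, faceCenterCell, middle, Fin.val_rev] <;> omega
  have key : ∀ (a : Fin 3) (ρ : Frame), ρ.dir a ∈ ({(2, true), (2, false)} : Finset Face) →
      (Frame.turnFun a ρ).img (2, true) = ρ.img (2, true) := by decide +kernel
  rw [layerTurn, partialTurn_apply]
  split_ifs with h
  · exact key a ρ (hsub h)
  · rfl

end TurnGroup

/-! ### Wings and centres -/

section Pi

variable {ι : Type*} [DecidableEq ι] {G : Type*} [Group G]

theorem conj_mulSingle (f : ι → G) (i : ι) (x : G) :
    f * Pi.mulSingle i x * f⁻¹ = Pi.mulSingle i (f i * x * (f i)⁻¹) := by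
  funext j
  by_cases h : j = i
  · subst h; simp
  · simp [h]

/-- The elements of `G` which, placed in the coordinate `i` and completed by `1` elsewhere, lie in
the subgroup `H` of the power of `G`. -/
def factor (H : Subgroup (ι → G)) (i : ι) : Subgroup G :=
  H.comap (MonoidHom.mulSingle (fun _ => G) i)

theorem mem_factor {H : Subgroup (ι → G)} {i : ι} {x : G} :
    x ∈ factor H i ↔ (Pi.mulSingle i x : ι → G) ∈ H := Iff.rfl

theorem conj_mem_factor {H : Subgroup (ι → G)} {f : ι → G}
    (hf : ∀ h ∈ H, f * h * f⁻¹ ∈ H) (i : ι) : ∀ x ∈ factor H i, f i * x * (f i)⁻¹ ∈ factor H i := by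
  intro x hx
  rw [mem_factor, ← conj_mulSingle]
  exact hf _ hx

end Pi

theorem eq_top_of_alternatingGroup_le {α : Type*} [Fintype α] [DecidableEq α]
    {K : Subgroup (Perm α)} (h : alternatingGroup α ≤ K) {q : Perm α} (hq : q ∈ K)
    (hs : Perm.sign q = -1) : K = ⊤ := by
  refine eq_top_iff.2 fun x _ => ?_
  rcases Int.units_eq_one_or (Perm.sign x) with hx | hx
  · exact h (Perm.mem_alternatingGroup.2 hx)
  · have : x * q ∈ K := h (Perm.mem_alternatingGroup.2 (by simp [hx, hs]))
    simpa using K.mul_mem this (K.inv_mem hq)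

section Wings

variable {m : ℕ}

/-- The action on the orbits of the corners and of the middle edges. -/
def cornerEdge (m : ℕ) : (Cell (m + 2) → Perm Frame) →* Perm Frame × Perm Frame :=
  (Pi.evalMonoidHom _ (cornerCell m)).prod (Pi.evalMonoidHom _ (edgeCell m))

/-- The action on the orbits of the wings. -/
def wings (m : ℕ) : (Cell (m + 2) → Perm Frame) →* (Fin (m / 2) → Perm Frame) :=
  MonoidHom.pi fun j => Pi.evalMonoidHom _ (wingCell j)

/-- The action on the orbits of the centres. -/
def centers (m : ℕ) :
    (Cell (m + 2) → Perm Frame) →* (Fin (m / 2) × Fin ((m + 1) / 2) → Perm Frame) :=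
  MonoidHom.pi fun i => Pi.evalMonoidHom _ (centerCell i.1 i.2)

theorem cornerEdge_apply (g : Cell (m + 2) → Perm Frame) :
    cornerEdge m g = (g (cornerCell m), g (edgeCell m)) := rfl

theorem wings_apply (g : Cell (m + 2) → Perm Frame) (j : Fin (m / 2)) :
    wings m g j = g (wingCell j) := rfl

theorem centers_apply (g : Cell (m + 2) → Perm Frame) (i : Fin (m / 2) × Fin ((m + 1) / 2)) :
    centers m g i = g (centerCell i.1 i.2) := rfl

/-- The subgroup that leaves the corners and middle edges in place. -/
def fixCornersEdges (m : ℕ) : Subgroup (Cell (m + 2) → Perm Frame) :=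
  turnGroup m ⊓ (cornerEdge m).ker

/-- The subgroup that leaves the corners, middle edges and wings in place. -/
def fixWings (m : ℕ) : Subgroup (Cell (m + 2) → Perm Frame) :=
  fixCornersEdges m ⊓ (wings m).ker

theorem conj_mem_fixCornersEdges {g x : Cell (m + 2) → Perm Frame} (hg : g ∈ turnGroup m)
    (hx : x ∈ fixCornersEdges m) : g * x * g⁻¹ ∈ fixCornersEdges m :=
  Subgroup.mem_inf.2 ⟨mul_mem (mul_mem hg hx.1) (inv_mem hg),
    (MonoidHom.normal_ker _).conj_mem _ hx.2 _⟩

theorem conj_mem_fixWings {g x : Cell (m + 2) → Perm Frame} (hg : g ∈ turnGroup m)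
    (hx : x ∈ fixWings m) : g * x * g⁻¹ ∈ fixWings m :=
  Subgroup.mem_inf.2 ⟨conj_mem_fixCornersEdges hg hx.1,
    (MonoidHom.normal_ker _).conj_mem _ hx.2 _⟩

theorem layerTurn_low_mem (a : Fin 3) (j : Fin (m / 2)) :
    layerTurn a (low j) ∈ fixCornersEdges m :=
  Subgroup.mem_inf.2 ⟨layerTurn_mem a (low_nonmid j), by
    rw [MonoidHom.mem_ker, cornerEdge_apply, layerTurn_low_corner, layerTurn_low_edge]; rfl⟩

/-- The wings can be permuted arbitrarily, independently in each orbit, while the corners and middle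
edges stay in place. The turns of the layer `low j` move no other wing orbit, and they are odd on
this one, so it is enough to find a 3-cycle in the group that they generate under conjugation. -/
theorem map_wings_eq_top : (fixCornersEdges m).map (wings m) = ⊤ := by
  have hconj : ∀ g ∈ turnGroup m, ∀ h ∈ (fixCornersEdges m).map (wings m),
      wings m g * h * (wings m g)⁻¹ ∈ (fixCornersEdges m).map (wings m) := by
    rintro g hg _ ⟨x, hx, rfl⟩
    exact ⟨_, conj_mem_fixCornersEdges hg hx, by simp⟩
  refine eq_top_iff.2 fun π _ => Subgroup.pi_mem_of_mulSingle_mem π fun j => ?_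
  rw [← mem_factor]
  set K := factor ((fixCornersEdges m).map (wings m)) j with hK
  have hq : partialTurn 0 {(0, true)} ∈ K := by
    refine ⟨_, layerTurn_low_mem 0 j, funext fun i => ?_⟩
    rw [wings_apply, layerTurn]
    by_cases h : i = j
    · subst h; simp [layerFaces_wing_low]
    · simp [layerFaces_wing_low_of_ne h, h]
  have hL : ∀ g ∈ turnGroup m, ∀ k ∈ K, g (wingCell j) * k * (g (wingCell j))⁻¹ ∈ K :=
    fun g hg => conj_mem_factor (hconj g hg) j
  -- The layer turns normalize `K`; on the wing orbit `j` they are the list `wingMoves`.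
  have hlast : ∀ i, ∀ k ∈ K, partialTurn i {(1, true), (2, true)} * k *
      (partialTurn i {(1, true), (2, true)})⁻¹ ∈ K := fun i => by
    simpa only [layerTurn, layerFaces_wing_last] using
      hL _ (layerTurn_mem i last_nonmid)
  have hzero : ∀ i, ∀ k ∈ K, partialTurn i {(1, false), (2, false)} * k *
      (partialTurn i {(1, false), (2, false)})⁻¹ ∈ K := fun i => by
    simpa only [layerTurn, layerFaces_wing_zero] using
      hL _ (layerTurn_mem i zero_nonmid)
  have hlow : ∀ i, ∀ k ∈ K, partialTurn i {(0, true)} * k *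
      (partialTurn i {(0, true)})⁻¹ ∈ K := fun i => by
    simpa only [layerTurn, layerFaces_wing_low] using
      hL _ (layerTurn_mem i (low_nonmid j))
  have hrev : ∀ i, ∀ k ∈ K, partialTurn i {(0, false)} * k *
      (partialTurn i {(0, false)})⁻¹ ∈ K := fun i => by
    simpa only [layerTurn, layerFaces_wing_low_rev] using
      hL _ (layerTurn_mem i (low_rev_nonmid j))
  have hcyc : wingCycle ∈ K := by
    have := hzero 1 _ (hzero 2 _ hq)
    rw [wingCycle, commutatorElement_def]
    refine mul_mem (mul_mem (mul_mem hq ?_) (inv_mem hq)) (inv_mem ?_) <;>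
    · convert this using 1
      simp only [mul_assoc, mul_inv_rev]
  obtain ⟨h3, x, hx⟩ := wingCycle_facts
  have : K = ⊤ := by
    refine eq_top_of_alternatingGroup_le
      (alternatingGroup_le_of_blockStep wingMoves ?_ hcyc h3 x _ hx) hq sign_wing
    intro g hg
    simp only [wingMoves, List.mem_flatMap, List.mem_cons, List.not_mem_nil, or_false] at hg
    obtain ⟨i, -, rfl | rfl | rfl | rfl⟩ := hg
    exacts [hlast i, hzero i, hlow i, hrev i]
  rw [this]
  trivial

end Wings

section Centers

variable {m : ℕ}

/-- The commutator of a turn of the layer `low j` with a turn, conjugated by the top layer, of the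
layer opposite to `lowMid k`. It only moves pieces of the orbit of `centerCell j k`. -/
def centerCommutator (j : Fin (m / 2)) (k : Fin ((m + 1) / 2)) : Cell (m + 2) → Perm Frame :=
  ⁅layerTurn 0 (low j), (layerTurn 2 (Fin.last _))⁻¹ * layerTurn 0 (lowMid k).rev *
    layerTurn 2 (Fin.last _)⁆

theorem centerCommutator_apply (j : Fin (m / 2)) (k : Fin ((m + 1) / 2)) (p : Cell (m + 2)) :
    centerCommutator j k p = ⁅partialTurn 0 (p.layerFaces (low j)),
      (partialTurn 2 (p.layerFaces (Fin.last _)))⁻¹ *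
        partialTurn 0 (p.layerFaces (lowMid k).rev) *
        partialTurn 2 (p.layerFaces (Fin.last _))⁆ := rfl

/-- If no copy of the position `p` lies in the crossing of the layers `low j`, `lowMid k` and the
top layer, then the two entries of the commutator have disjoint supports on these copies. -/
theorem centerCommutator_eq_one {j : Fin (m / 2)} {k : Fin ((m + 1) / 2)} {p : Cell (m + 2)}
    (hp : ∀ ρ : Frame, p.level (ρ.dir 0) = low j → p.level (ρ.dir 1) = lowMid k →
      p.level (ρ.dir 2) ≠ Fin.last _) : centerCommutator j k p = 1 := by
  rw [centerCommutator_apply, commutatorElement_eq_one_iff_mul_comm]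
  refine (Perm.Disjoint.commute fun ρ => ?_).eq
  by_cases h0 : p.level (ρ.dir 0) = low j
  · right
    rw [Perm.mul_apply, Perm.mul_apply, Perm.inv_eq_iff_eq]
    have hne : p.level ((partialTurn 2 (p.layerFaces (Fin.last _)) ρ).dir 0) ≠ (lowMid k).rev := by
      rw [partialTurn_apply]
      split_ifs with h2
      · rw [mem_layerFaces] at h2
        intro h
        have h1 : (Frame.turnFun 2 ρ).dir 0 = ((ρ.dir 1).1, !(ρ.dir 1).2) := by
          rw [Frame.dir_turnFun]; rfl
        rw [h1, Cell.level_not] at h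
        exact hp ρ h0 (Fin.rev_injective h) h2
      · rw [h0]
        simp only [low, lowMid, Ne, Fin.ext_iff, Fin.val_rev]
        omega
    rw [partialTurn_apply 0, if_neg (by rwa [mem_layerFaces])]
  · left
    rw [partialTurn_apply, if_neg (by rwa [mem_layerFaces])]

/-- The four rotations that fix the top direction. -/
theorem dir_of_dir_two : ∀ ρ : Frame, ρ.dir 2 = (2, true) →
    (ρ.dir 0 = (0, true) ∧ ρ.dir 1 = (1, true)) ∨ (ρ.dir 0 = (1, false) ∧ ρ.dir 1 = (0, true)) ∨
    (ρ.dir 0 = (0, false) ∧ ρ.dir 1 = (1, false)) ∨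
    (ρ.dir 0 = (1, true) ∧ ρ.dir 1 = (0, false)) := by
  decide +kernel

theorem dir_axis_ne : ∀ ρ : Frame, (ρ.dir 0).1 ≠ (ρ.dir 1).1 := by decide +kernel

theorem centerCommutator_wing (j : Fin (m / 2)) (k : Fin ((m + 1) / 2)) (i : Fin (m / 2)) :
    centerCommutator j k (wingCell i) = 1 := by
  have key : ∀ f : Face, 1 ≤ ((wingCell i).level f : ℕ) → ((wingCell i).level f : ℕ) ≤ m →
      f.1 = 0 := by
    rintro ⟨a, s⟩
    fin_cases a <;> cases s <;> simp [Cell.level, wingCell]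
  refine centerCommutator_eq_one fun ρ h0 h1 _ => dir_axis_ne ρ ?_
  rw [key _ (by rw [h0]; simp [low]) (by rw [h0]; simp [low]; omega),
    key _ (by rw [h1]; simp [lowMid]) (by rw [h1]; simp [lowMid]; omega)]

theorem centerCommutator_center_of_ne {j j' : Fin (m / 2)} {k k' : Fin ((m + 1) / 2)}
    (h : (j', k') ≠ (j, k)) :
    centerCommutator j k (centerCell j' k') = 1 := by
  simp only [Ne, Prod.mk.injEq, Fin.ext_iff] at h
  refine centerCommutator_eq_one fun ρ h0 h1 h2 => ?_
  have hz : ρ.dir 2 = (2, true) := by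
    rw [← mem_layerFaces, layerFaces_center_last] at h2
    simpa using h2
  rcases dir_of_dir_two ρ hz with ⟨e0, e1⟩ | ⟨e0, e1⟩ | ⟨e0, e1⟩ | ⟨e0, e1⟩ <;>
    rw [e0] at h0 <;> rw [e1] at h1 <;>
    simp [Cell.level, centerCell, low, lowMid, Fin.ext_iff, Fin.val_rev] at h0 h1 <;> omega

theorem centerCommutator_mem (j : Fin (m / 2)) {k : Fin ((m + 1) / 2)}
    (hk : 2 * (lowMid k : ℕ) ≠ m + 1) : centerCommutator j k ∈ fixWings m := by
  have hk' : 2 * ((lowMid k).rev : ℕ) ≠ m + 1 := by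
    rw [Fin.val_rev]; omega
  have h0 := layerTurn_low_mem (m := m) 0 j
  have hu : layerTurn (n := m + 2) 2 (Fin.last _) ∈ turnGroup m := layerTurn_mem 2 last_nonmid
  have hg := mul_mem (mul_mem (inv_mem hu) (layerTurn_mem 0 hk')) hu
  refine Subgroup.mem_inf.2 ⟨?_, ?_⟩
  · have := mul_mem h0 (conj_mem_fixCornersEdges hg (inv_mem h0))
    rw [centerCommutator, commutatorElement_def]
    simpa only [mul_assoc] using this
  · exact MonoidHom.mem_ker.2 (funext fun i => centerCommutator_wing j k i)

theorem conj_mem_map_centers {g : Cell (m + 2) → Perm Frame} (hg : g ∈ turnGroup m) :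
    ∀ h ∈ (fixWings m).map (centers m),
      centers m g * h * (centers m g)⁻¹ ∈ (fixWings m).map (centers m) := by
  rintro _ ⟨x, hx, rfl⟩
  exact ⟨_, conj_mem_fixWings hg hx, by simp⟩

/-- A 3-cycle in the factor of a centre orbit generates the alternating group under conjugation by
the layer turns. -/
theorem alternatingGroup_le_factor_centers (j : Fin (m / 2)) (k : Fin ((m + 1) / 2))
    {S T : Finset Face} (hS : (centerCell j k).layerFaces (low j) = S)
    (hT : (centerCell j k).layerFaces (low j).rev = T) {t : Perm Frame}
    (htK : t ∈ factor ((fixWings m).map (centers m)) (j, k)) (h3 : t.support.card = 3) {i : ℕ}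
    (hi : (blockStep (centerMoves S T))^[i] {0, t 0} = Finset.univ) :
    alternatingGroup Frame ≤ factor ((fixWings m).map (centers m)) (j, k) := by
  refine alternatingGroup_le_of_blockStep (centerMoves S T) ?_ htK h3 0 i hi
  intro g hg
  have hL : ∀ a (l : Fin (m + 2)), 2 * (l : ℕ) ≠ m + 1 →
      ∀ k' ∈ factor ((fixWings m).map (centers m)) (j, k),
      partialTurn a ((centerCell j k).layerFaces l) * k' *
        (partialTurn a ((centerCell j k).layerFaces l))⁻¹ ∈
          factor ((fixWings m).map (centers m)) (j, k) := fun a l hl =>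
    conj_mem_factor (conj_mem_map_centers (layerTurn_mem a hl)) (j, k)
  simp only [centerMoves, List.mem_flatMap, List.mem_cons, List.not_mem_nil, or_false] at hg
  obtain ⟨a, -, rfl | rfl | rfl | rfl⟩ := hg
  · rw [← layerFaces_center_last j k]; exact hL a _ last_nonmid
  · rw [← layerFaces_center_zero j k]; exact hL a _ zero_nonmid
  · rw [← hS]; exact hL a _ (low_nonmid j)
  · rw [← hT]; exact hL a _ (low_rev_nonmid j)

theorem alternatingGroup_le_factor_of_nonmid (j : Fin (m / 2)) {k : Fin ((m + 1) / 2)}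
    (hk : 2 * (lowMid k : ℕ) ≠ m + 1) :
    alternatingGroup Frame ≤ factor ((fixWings m).map (centers m)) (j, k) := by
  have hmem : centerCommutator j k (centerCell j k) ∈
      factor ((fixWings m).map (centers m)) (j, k) := by
    refine ⟨_, centerCommutator_mem j hk, funext fun i => ?_⟩
    rw [centers_apply]
    by_cases h : i = (j, k)
    · subst h; simp
    · rw [centerCommutator_center_of_ne h]; simp [h]
  rw [centerCommutator_apply, layerFaces_center_last] at hmem
  by_cases h : (k : ℕ) = j
  · have : lowMid k = low j := by simp [lowMid, low, h]
    rw [this, layerFaces_center_diag h, layerFaces_center_diag_rev h] at hmem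
    exact alternatingGroup_le_factor_centers j k (layerFaces_center_diag h)
      (layerFaces_center_diag_rev h) hmem centerCycle_pair.1 centerCycle_pair.2
  · rw [layerFaces_center_low h, layerFaces_center_lowMid_rev h hk] at hmem
    exact alternatingGroup_le_factor_centers j k (layerFaces_center_low h)
      (layerFaces_center_low_rev h) hmem centerCycle_single.1 centerCycle_single.2

/-- For a centre on a middle line, `centerCommutator` is not available, since the middle layers are
not turned. The fifth power of a simpler commutator fixes all wings and is a 3-cycle on this orbit;
on the centres off the middle lines it is some even permutation, which is corrected by
`alternatingGroup_le_factor_of_nonmid`. -/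
theorem alternatingGroup_le_factor_of_mid (j : Fin (m / 2)) {k : Fin ((m + 1) / 2)}
    (hk : 2 * (lowMid k : ℕ) = m + 1) :
    alternatingGroup Frame ≤ factor ((fixWings m).map (centers m)) (j, k) := by
  have hkj : (k : ℕ) ≠ j := by
    simp only [lowMid] at hk; omega
  let u : Cell (m + 2) → Perm Frame := ⁅layerTurn 0 (low j), layerTurn 2 (Fin.last _)⁆ ^ 5
  have hu_apply : ∀ p, u p = ⁅partialTurn 0 (p.layerFaces (low j)),
      partialTurn 2 (p.layerFaces (Fin.last _))⁆ ^ 5 := fun _ => rfl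
  have hu : u ∈ fixWings m := by
    have h0 := layerTurn_low_mem (m := m) 0 j
    refine Subgroup.mem_inf.2 ⟨pow_mem ?_ 5, MonoidHom.mem_ker.2 (funext fun i => ?_)⟩
    · have := mul_mem h0 (conj_mem_fixCornersEdges (layerTurn_mem 2 last_nonmid) (inv_mem h0))
      rw [commutatorElement_def]
      simpa only [mul_assoc] using this
    · rw [wings_apply, hu_apply]
      by_cases h : i = j
      · subst h
        rw [layerFaces_wing_low, layerFaces_wing_last, midCycle_wing]; rfl
      · rw [layerFaces_wing_low_of_ne h, partialTurn_empty, commutatorElement_one_left, one_pow]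
        rfl
  -- The components of `u` at the centres off the middle lines: a commutator is even.
  have hy : (fun i : Fin (m / 2) × Fin ((m + 1) / 2) =>
      if 2 * (lowMid i.2 : ℕ) = m + 1 then 1 else centers m u i) ∈
        (fixWings m).map (centers m) := by
    refine Subgroup.pi_mem_of_mulSingle_mem _ fun i => ?_
    split_ifs with h
    · rw [Pi.mulSingle_one]; exact one_mem _
    · refine alternatingGroup_le_factor_of_nonmid i.1 h (Perm.mem_alternatingGroup.2 ?_)
      rw [centers_apply, hu_apply, map_pow, map_commutatorElement,
        commutatorElement_eq_one_iff_mul_comm.2 (mul_comm _ _), one_pow]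
  have hmem : u (centerCell j k) ∈ factor ((fixWings m).map (centers m)) (j, k) := by
    rw [mem_factor]
    convert mul_mem (Subgroup.mem_map_of_mem _ hu) (inv_mem hy) using 1
    funext i
    simp only [Pi.mul_apply, Pi.inv_apply]
    by_cases h : i = (j, k)
    · subst h; simp [hk, centers_apply]
    · rw [Pi.mulSingle_eq_of_ne h]
      split_ifs with hi
      · have hne : i.1 ≠ j := by
          intro h1
          refine h (Prod.ext h1 (Fin.ext ?_))
          change (i.2 : ℕ) = k
          simp only [lowMid] at hi hk
          omega
        rw [centers_apply, hu_apply, layerFaces_center_low_of_ne hne hi, partialTurn_empty,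
          commutatorElement_one_left]
        simp
      · simp
  rw [hu_apply, layerFaces_center_low hkj, layerFaces_center_last] at hmem
  exact alternatingGroup_le_factor_centers j k (layerFaces_center_low hkj)
    (layerFaces_center_low_rev hkj) hmem midCycle_facts.1 midCycle_facts.2

/-- The centres can be permuted independently in each orbit by even permutations, while the corners,
edges and wings stay in place. -/
theorem mem_map_centers_of_even {π : Fin (m / 2) × Fin ((m + 1) / 2) → Perm Frame}
    (hπ : ∀ i, Perm.sign (π i) = 1) : π ∈ (fixWings m).map (centers m) := by
  refine Subgroup.pi_mem_of_mulSingle_mem _ fun i => ?_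
  by_cases h : 2 * (lowMid i.2 : ℕ) = m + 1
  · exact alternatingGroup_le_factor_of_mid i.1 h (Perm.mem_alternatingGroup.2 (hπ i))
  · exact alternatingGroup_le_factor_of_nonmid i.1 h (Perm.mem_alternatingGroup.2 (hπ i))

end Centers

/-! ### Generalized symmetric groups -/

section Monomial

variable {k r : ℕ}

/-- The generalized symmetric group: permutations of `k` pieces, each of which has one of `r`
orientations. The element with components `f` and `σ` moves piece `i` to the place `σ i` and adds
`f (σ i)` to its orientation. -/
abbrev Monomial (k r : ℕ) : Type :=
  (Fin k → Multiplicative (ZMod r)) ⋊[mulAutArrow] Perm (Fin k)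

namespace Monomial

theorem mul_left_apply (g h : Monomial k r) (i : Fin k) :
    (g * h).left i = g.left i * h.left (g.right⁻¹ i) := rfl

/-- The total change of orientation. -/
def twist (k r : ℕ) : Monomial k r →* Multiplicative (ZMod r) where
  toFun g := ∏ i, g.left i
  map_one' := by simp
  map_mul' g h := by
    simp only [mul_left_apply, Finset.prod_mul_distrib]
    rw [Equiv.prod_comp g.right⁻¹ h.left]

theorem twist_apply (g : Monomial k r) : twist k r g = ∏ i, g.left i := rfl

/-- The action on pairs of a piece and an orientation. -/
def act (k r : ℕ) : Monomial k r →* Perm (Fin k × ZMod r) where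
  toFun g :=
    { toFun := fun x => (g.right x.1, x.2 + (g.left (g.right x.1)).toAdd)
      invFun := fun x => (g.right⁻¹ x.1, x.2 - (g.left x.1).toAdd)
      left_inv := fun x => by simp
      right_inv := fun x => by simp }
  map_one' := by ext x <;> simp
  map_mul' g h := by
    ext x
    · simp
    · simp [mul_left_apply]; ring

theorem act_apply (g : Monomial k r) (x : Fin k × ZMod r) :
    act k r g x = (g.right x.1, x.2 + (g.left (g.right x.1)).toAdd) := rfl

theorem act_injective : Function.Injective (act k r) := by
  intro g h hgh
  have hx : ∀ i, act k r g (i, 0) = act k r h (i, 0) := fun i => by rw [hgh]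
  have hr : g.right = h.right := Equiv.ext fun i => congrArg Prod.fst (hx i)
  refine SemidirectProduct.ext (funext fun i => ?_) hr
  have := congrArg Prod.snd (hx (g.right.symm i))
  simpa [act_apply, ← hr] using this

/-- A permutation of the pairs that commutes with the shifts of the orientation comes from an
element of the generalized symmetric group. -/
def ofPerm (f : Perm (Fin k × ZMod r))
    (h : ∀ i x, f (i, x) = ((f (i, 0)).1, x + (f (i, 0)).2)) : Monomial k r where
  left i := .ofAdd (f ((f.symm (i, 0)).1, 0)).2
  right :=
    { toFun := fun i => (f (i, 0)).1
      invFun := fun i => (f.symm (i, 0)).1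
      left_inv := fun i => by
        have : f.symm ((f (i, 0)).1, 0) = (i, -(f (i, 0)).2) := by
          rw [Equiv.symm_apply_eq, h i (-_), neg_add_cancel]
        simp only [this]
      right_inv := fun i => by
        have := h (f.symm (i, 0)).1 (f.symm (i, 0)).2
        rw [Prod.mk.eta, Equiv.apply_symm_apply] at this
        exact (congrArg Prod.fst this).symm }

theorem act_ofPerm (f : Perm (Fin k × ZMod r))
    (h : ∀ i x, f (i, x) = ((f (i, 0)).1, x + (f (i, 0)).2)) : act k r (ofPerm f h) = f := by
  ext1 ⟨i, x⟩
  rw [h i x, act_apply]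
  have : (f.symm ((f (i, 0)).1, 0)).1 = i := (ofPerm f h).right.left_inv i
  simp [ofPerm, this]

theorem conj_inl (g : Monomial k r) (f : Fin k → Multiplicative (ZMod r)) :
    g * SemidirectProduct.inl f * g⁻¹ = SemidirectProduct.inl (mulAutArrow g.right f) := by
  rw [mul_inv_eq_iff_eq_mul]
  ext1
  · funext i
    rw [mul_left_apply, mul_comm]
    rfl
  · simp

theorem mulAutArrow_mulSingle (σ : Perm (Fin k)) (i : Fin k) (x : Multiplicative (ZMod r)) :
    mulAutArrow σ (Pi.mulSingle i x : Fin k → Multiplicative (ZMod r)) =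
      Pi.mulSingle (σ i) x := by
  funext j
  change (Pi.mulSingle i x : Fin k → Multiplicative (ZMod r)) (σ⁻¹ j) = _
  by_cases h : j = σ i
  · subst h; simp
  · rw [Pi.mulSingle_eq_of_ne h, Pi.mulSingle_eq_of_ne]
    rwa [Ne, Perm.inv_eq_iff_eq]

theorem exists_even_perm (hk : 4 ≤ k) {p q i j : Fin k} (hpq : p ≠ q) (hij : i ≠ j) :
    ∃ σ : Perm (Fin k), Perm.sign σ = 1 ∧ σ p = i ∧ σ q = j := by
  obtain ⟨σ, hp, hq⟩ : ∃ σ : Perm (Fin k), σ p = i ∧ σ q = j := by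
    refine ⟨swap (swap p i q) j * swap p i, ?_, by simp⟩
    rw [Perm.mul_apply, swap_apply_left, swap_apply_of_ne_of_ne _ hij]
    intro h
    rw [eq_comm, swap_apply_eq_iff, swap_apply_right] at h
    exact hpq h.symm
  rcases Int.units_eq_one_or (Perm.sign σ) with hs | hs
  · exact ⟨σ, hs, hp, hq⟩
  · have hcard : 1 < (({p, q} : Finset (Fin k))ᶜ).card := by
      rw [Finset.card_compl, Finset.card_pair hpq, Fintype.card_fin]; omega
    obtain ⟨c, hc, d, hd, hcd⟩ := Finset.one_lt_card.1 hcard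
    simp only [Finset.mem_compl, Finset.mem_insert, Finset.mem_singleton, not_or] at hc hd
    refine ⟨σ * swap c d, by simp [hs, hcd], ?_, ?_⟩
    · rw [Perm.mul_apply, swap_apply_of_ne_of_ne (Ne.symm hc.1) (Ne.symm hd.1), hp]
    · rw [Perm.mul_apply, swap_apply_of_ne_of_ne (Ne.symm hc.2) (Ne.symm hd.2), hq]

/-- A subgroup `K` of the twist-free elements contains all of them whose underlying permutation is
even, provided that the permutations underlying `K` include the even ones and that `K` contains an
element that only twists two pieces, by `1` and `-1`. Conjugates of the latter twist any two
pieces, and they generate all twist-free changes of orientation. -/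
theorem mem_of_alternatingGroup_le [NeZero r] (hk : 4 ≤ k) {K : Subgroup (Monomial k r)}
    (hK : ∀ g ∈ K, twist k r g = 1)
    (halt : alternatingGroup (Fin k) ≤ K.map SemidirectProduct.rightHom) {p q : Fin k}
    (hpq : p ≠ q)
    (hδ : SemidirectProduct.inl (Pi.mulSingle p (.ofAdd 1) * (Pi.mulSingle q (.ofAdd 1))⁻¹) ∈ K)
    {g : Monomial k r} (hg : twist k r g = 1) (hs : Perm.sign g.right = 1) : g ∈ K := by
  let N : Subgroup (Fin k → Multiplicative (ZMod r)) := K.comap SemidirectProduct.inl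
  have hN1 : ∀ i, Pi.mulSingle i (.ofAdd 1) * (Pi.mulSingle p (.ofAdd 1))⁻¹ ∈ N := by
    intro i
    by_cases hi : i = p
    · subst hi; rw [mul_inv_cancel]; exact one_mem _
    obtain ⟨σ, h1, hp, hq⟩ := exists_even_perm hk hpq hi
    obtain ⟨κ, hκ, rfl⟩ := halt (Perm.mem_alternatingGroup.2 h1)
    have := K.mul_mem (K.mul_mem hκ hδ) (K.inv_mem hκ)
    rw [conj_inl, map_mul, map_inv, mulAutArrow_mulSingle, mulAutArrow_mulSingle] at this
    rw [SemidirectProduct.rightHom_eq_right] at hp hq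
    rwa [hp, hq] at this
  have hN2 : ∀ i (y : Multiplicative (ZMod r)),
      Pi.mulSingle i y * (Pi.mulSingle p y)⁻¹ ∈ N := by
    intro i y
    have hy : y = (Multiplicative.ofAdd (1 : ZMod r)) ^ y.toAdd.val := by
      rw [← ofAdd_nsmul, nsmul_one, ZMod.natCast_val, ZMod.cast_id]; rfl
    have := N.pow_mem (hN1 i) y.toAdd.val
    rw [mul_pow, inv_pow, ← Pi.mulSingle_pow, ← Pi.mulSingle_pow, ← hy] at this
    exact this
  have hN3 : ∀ f : Fin k → Multiplicative (ZMod r), ∏ i, f i = 1 → f ∈ N := by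
    intro f hf
    have := N.prod_mem (t := Finset.univ) fun i _ => hN2 i (f i)
    rw [Finset.prod_mul_distrib, Finset.univ_prod_mulSingle, Finset.prod_inv_distrib] at this
    have h1 : ∏ i, (Pi.mulSingle p (f i) : Fin k → Multiplicative (ZMod r)) = 1 := by
      have := map_prod (MonoidHom.mulSingle (fun _ : Fin k => Multiplicative (ZMod r)) p) f
        Finset.univ
      rw [hf, map_one] at this
      exact this.symm
    simpa [h1] using this
  obtain ⟨κ, hκ, hr⟩ := halt (Perm.mem_alternatingGroup.2 hs)
  rw [SemidirectProduct.rightHom_eq_right] at hr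
  have hinl : g * κ⁻¹ = SemidirectProduct.inl (g * κ⁻¹).left := by
    ext1
    · simp
    · simp [hr]
  have ht : twist k r (g * κ⁻¹) = 1 := by rw [map_mul, map_inv, hg, hK κ hκ]; simp
  have : g * κ⁻¹ ∈ K := by
    rw [hinl]
    exact hN3 _ ht
  simpa using K.mul_mem this hκ

end Monomial

end Monomial

/-! ### Corners and middle edges -/

section CornersEdges

/-- The numbering of the rotated copies of the corner by place and orientation. The place is the
sign pattern of the rotation, which is its quotient by 3. -/
def cornerEquiv : Frame ≃ Fin 8 × ZMod 3 := (finProdFinEquiv (m := 8) (n := 3)).symm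

/-- A numbering of the rotations in which the numbers `2 * i` and `2 * i + 1` belong to the two
rotations that carry the middle edge to the same place. -/
def edgeNumber : Frame ≃ Fin (12 * 2) where
  toFun := ![0, 2, 4, 6, 8, 1, 5, 10, 12, 13, 14, 7, 16, 3, 18, 19, 9, 20, 22, 11, 17, 21, 15, 23]
  invFun := ![0, 5, 1, 13, 2, 6, 3, 11, 4, 16, 7, 19, 8, 9, 10, 22, 12, 20, 14, 15, 17, 21, 18, 23]
  left_inv := by
    change ∀ ρ, _
    decide +kernel
  right_inv := by
    change ∀ x, _
    decide +kernel

/-- The numbering of the rotated copies of the middle edge by place and orientation. -/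
def edgeEquiv : Frame ≃ Fin 12 × ZMod 2 :=
  edgeNumber.trans (finProdFinEquiv (m := 12) (n := 2)).symm

/-- The directions in which the reference corner lies in the last, or the first, layer. -/
def cornerFaces (s : Bool) : Finset Face := {(0, s), (1, s), (2, s)}

/-- The directions in which the reference edge lies in the last, or the first, layer. -/
def edgeFaces (s : Bool) : Finset Face := {(1, s), (2, s)}

/-- The turn of an outer layer about axis `a` as it acts on the corners. -/
def cornerTurn (a : Fin 3) (s : Bool) : Monomial 8 3 :=
  Monomial.ofPerm (cornerEquiv.permCongr (partialTurn a (cornerFaces s))) (by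
    revert a s; decide +kernel)

/-- The turn of an outer layer about axis `a` as it acts on the middle edges. -/
def edgeTurn (a : Fin 3) (s : Bool) : Monomial 12 2 :=
  Monomial.ofPerm (edgeEquiv.permCongr (partialTurn a (edgeFaces s))) (by
    revert a s; decide +kernel)

theorem cornerTurn_twist : ∀ a s, Monomial.twist 8 3 (cornerTurn a s) = 1 := by decide +kernel
theorem edgeTurn_twist : ∀ a s, Monomial.twist 12 2 (edgeTurn a s) = 1 := by decide +kernel
theorem cornerTurn_sign : ∀ a s, Perm.sign (cornerTurn a s).right = -1 := by decide +kernel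
theorem edgeTurn_sign : ∀ a s, Perm.sign (edgeTurn a s).right = -1 := by decide +kernel

/-- The action of the corner group on rotations. -/
def cornerAct : Monomial 8 3 →* Perm Frame :=
  (cornerEquiv.symm.permCongrHom).toMonoidHom.comp (Monomial.act 8 3)

/-- The action of the edge group on rotations. -/
def edgeAct : Monomial 12 2 →* Perm Frame :=
  (edgeEquiv.symm.permCongrHom).toMonoidHom.comp (Monomial.act 12 2)

theorem cornerAct_injective : Function.Injective cornerAct :=
  (cornerEquiv.symm.permCongrHom).injective.comp Monomial.act_injective

theorem edgeAct_injective : Function.Injective edgeAct :=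
  (edgeEquiv.symm.permCongrHom).injective.comp Monomial.act_injective

theorem cornerAct_cornerTurn (a : Fin 3) (s : Bool) :
    cornerAct (cornerTurn a s) = partialTurn a (cornerFaces s) := by
  ext1 ρ
  simp [cornerAct, cornerTurn, Monomial.act_ofPerm]

theorem edgeAct_edgeTurn (a : Fin 3) (s : Bool) :
    edgeAct (edgeTurn a s) = partialTurn a (edgeFaces s) := by
  ext1 ρ
  simp [edgeAct, edgeTurn, Monomial.act_ofPerm]

section Words

variable {G G' : Type*} [Group G] [Group G']

/-- A word in the outer turns that permutes three corners in a cycle and fixes all edges. -/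
def cornerCycleWord (t : Fin 3 → Bool → G) : G :=
  ⁅t 0 false, t 1 false * t 0 true * (t 1 false)⁻¹⁆

/-- A word that only twists two corners, in opposite senses. -/
def cornerTwistWord (t : Fin 3 → Bool → G) : G := ⁅t 0 false, ⁅t 0 true, t 1 false⁆ ^ 2⁆

/-- A word that permutes three edges in a cycle and is even on the corners. -/
def edgeCycleWord (t : Fin 3 → Bool → G) : G := ⁅t 0 true, t 2 true⁆

/-- A word that flips two edges, fixes the other edges, and is even on the corners. -/
def edgeFlipWord (t : Fin 3 → Bool → G) : G :=
  t 0 false * t 1 false * (t 0 false)⁻¹ * t 1 false * (t 2 false)⁻¹ * (t 1 false)⁻¹ * t 2 false *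
    (t 1 false)⁻¹

variable {H : Subgroup (G × G')} {c : Fin 3 → Bool → G} {e : Fin 3 → Bool → G'}

theorem commutatorElement_mem {H : Subgroup G} {x y : G} (hx : x ∈ H) (hy : y ∈ H) : ⁅x, y⁆ ∈ H :=
  mul_mem (mul_mem (mul_mem hx hy) (inv_mem hx)) (inv_mem hy)

theorem cornerCycleWord_mem (h : ∀ a s, (c a s, e a s) ∈ H) :
    (cornerCycleWord c, cornerCycleWord e) ∈ H :=
  commutatorElement_mem (h 0 false)
    (mul_mem (mul_mem (h 1 false) (h 0 true)) (inv_mem (h 1 false)))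

theorem cornerTwistWord_mem (h : ∀ a s, (c a s, e a s) ∈ H) :
    (cornerTwistWord c, cornerTwistWord e) ∈ H :=
  commutatorElement_mem (h 0 false) (pow_mem (commutatorElement_mem (h 0 true) (h 1 false)) 2)

theorem edgeCycleWord_mem (h : ∀ a s, (c a s, e a s) ∈ H) :
    (edgeCycleWord c, edgeCycleWord e) ∈ H :=
  commutatorElement_mem (h 0 true) (h 2 true)

theorem edgeFlipWord_mem (h : ∀ a s, (c a s, e a s) ∈ H) :
    (edgeFlipWord c, edgeFlipWord e) ∈ H :=
  mul_mem (mul_mem (mul_mem (mul_mem (mul_mem (mul_mem (mul_mem (h 0 false) (h 1 false))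
    (inv_mem (h 0 false))) (h 1 false)) (inv_mem (h 2 false))) (inv_mem (h 1 false))) (h 2 false))
    (inv_mem (h 1 false))

end Words

theorem cornerCycleWord_edgeTurn : cornerCycleWord edgeTurn = 1 := by
  apply edgeAct_injective
  simp only [cornerCycleWord, map_commutatorElement, map_mul, map_inv, map_one, edgeAct_edgeTurn]
  decide +kernel

theorem cornerTwistWord_edgeTurn : cornerTwistWord edgeTurn = 1 := by
  apply edgeAct_injective
  simp only [cornerTwistWord, map_commutatorElement, map_pow, map_one, edgeAct_edgeTurn]
  decide +kernel

theorem cornerCycleWord_cornerTurn :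
    (cornerCycleWord cornerTurn).right.support.card = 3 ∧
    (blockStep ((List.finRange 3).flatMap fun a =>
        [(cornerTurn a true).right, (cornerTurn a false).right]))^[3]
      {7, (cornerCycleWord cornerTurn).right 7} = Finset.univ := by
  decide +kernel

theorem cornerTwistWord_cornerTurn : cornerTwistWord cornerTurn =
    SemidirectProduct.inl (Pi.mulSingle 5 (.ofAdd 1) * (Pi.mulSingle 7 (.ofAdd 1))⁻¹) := by
  apply cornerAct_injective
  simp only [cornerTwistWord, map_commutatorElement, map_pow, cornerAct_cornerTurn]
  decide +kernel

theorem edgeCycleWord_edgeTurn : (edgeCycleWord edgeTurn).right.support.card = 3 ∧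
    (blockStep ((List.finRange 3).flatMap fun a =>
        [(edgeTurn a true).right, (edgeTurn a false).right]))^[3]
      {0, (edgeCycleWord edgeTurn).right 0} = Finset.univ := by
  decide +kernel

theorem edgeFlipWord_edgeTurn : edgeFlipWord edgeTurn =
    SemidirectProduct.inl (Pi.mulSingle 6 (.ofAdd 1) * (Pi.mulSingle 10 (.ofAdd 1))⁻¹) := by
  apply edgeAct_injective
  simp only [edgeFlipWord, map_mul, map_inv, edgeAct_edgeTurn]
  decide +kernel

theorem sign_edgeCycleWord : Perm.sign (edgeCycleWord cornerTurn).right = 1 := by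
  simp [edgeCycleWord, commutatorElement_def, cornerTurn_sign]

theorem sign_edgeFlipWord : Perm.sign (edgeFlipWord cornerTurn).right = 1 := by
  simp [edgeFlipWord, cornerTurn_sign]

end CornersEdges

/-! ### The configurations of corners and middle edges -/

section Reachable

/-- The group generated by the outer turns on corners and middle edges. -/
def reachable : Subgroup (Monomial 8 3 × Monomial 12 2) :=
  Subgroup.closure (Set.range fun x : Fin 3 × Bool => (cornerTurn x.1 x.2, edgeTurn x.1 x.2))

theorem turn_mem_reachable (a : Fin 3) (s : Bool) :
    (cornerTurn a s, edgeTurn a s) ∈ reachable :=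
  Subgroup.subset_closure ⟨(a, s), rfl⟩

/-- The three invariants of the outer turns: the total twist of the corners, the total flip of the
edges, and the product of the signs of the two permutations. -/
def invariants : Monomial 8 3 × Monomial 12 2 →*
    (Multiplicative (ZMod 3) × Multiplicative (ZMod 2)) × ℤˣ :=
  (((Monomial.twist 8 3).comp (MonoidHom.fst _ _)).prod
    ((Monomial.twist 12 2).comp (MonoidHom.snd _ _))).prod
  ((Perm.sign.comp (SemidirectProduct.rightHom.comp (MonoidHom.fst _ _))) *
    (Perm.sign.comp (SemidirectProduct.rightHom.comp (MonoidHom.snd _ _))))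

theorem invariants_apply (x : Monomial 8 3 × Monomial 12 2) :
    invariants x = ((Monomial.twist 8 3 x.1, Monomial.twist 12 2 x.2),
      Perm.sign x.1.right * Perm.sign x.2.right) := rfl

theorem mem_ker_invariants {x : Monomial 8 3 × Monomial 12 2} :
    x ∈ invariants.ker ↔ Monomial.twist 8 3 x.1 = 1 ∧ Monomial.twist 12 2 x.2 = 1 ∧
      Perm.sign x.1.right = Perm.sign x.2.right := by
  rw [MonoidHom.mem_ker, invariants_apply, Prod.mk_eq_one, Prod.mk_eq_one, and_assoc,
    mul_eq_one_iff_eq_inv, Int.units_inv_eq_self]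

theorem reachable_le : reachable ≤ invariants.ker := by
  rw [reachable, Subgroup.closure_le]
  rintro _ ⟨⟨a, s⟩, rfl⟩
  exact mem_ker_invariants.2 ⟨cornerTurn_twist a s, edgeTurn_twist a s,
    (cornerTurn_sign a s).trans (edgeTurn_sign a s).symm⟩

/-- Twist-free and even changes of the corners are possible with all edges fixed. -/
theorem mem_reachable_of_corner {g : Monomial 8 3} (hg : Monomial.twist 8 3 g = 1)
    (hs : Perm.sign g.right = 1) : (g, 1) ∈ reachable := by
  let K : Subgroup (Monomial 8 3) := reachable.comap (MonoidHom.inl _ _)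
  have hconj : ∀ a s, ∀ x ∈ K, cornerTurn a s * x * (cornerTurn a s)⁻¹ ∈ K := by
    intro a s x hx
    have := mul_mem (mul_mem (turn_mem_reachable a s) hx) (inv_mem (turn_mem_reachable a s))
    simpa [K] using this
  have hcyc : cornerCycleWord cornerTurn ∈ K := by
    have h := cornerCycleWord_mem turn_mem_reachable
    rwa [cornerCycleWord_edgeTurn] at h
  have htw : cornerTwistWord cornerTurn ∈ K := by
    have h := cornerTwistWord_mem turn_mem_reachable
    rwa [cornerTwistWord_edgeTurn] at h
  rw [cornerTwistWord_cornerTurn] at htw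
  change g ∈ K
  refine Monomial.mem_of_alternatingGroup_le (p := 5) (q := 7) (by norm_num)
    (fun x hx => (mem_ker_invariants.1 (reachable_le hx)).1) ?_ (by decide)
    htw hg hs
  refine alternatingGroup_le_of_blockStep _ ?_ ⟨_, hcyc, rfl⟩ cornerCycleWord_cornerTurn.1 7 _
    cornerCycleWord_cornerTurn.2
  have hL : ∀ a s, ∀ k ∈ K.map SemidirectProduct.rightHom,
      (cornerTurn a s).right * k * (cornerTurn a s).right⁻¹ ∈
        K.map SemidirectProduct.rightHom := by
    rintro a s _ ⟨x, hx, rfl⟩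
    exact ⟨_, hconj a s x hx, by simp⟩
  intro σ hσ
  simp only [List.mem_flatMap, List.mem_cons, List.not_mem_nil, or_false] at hσ
  obtain ⟨a, -, rfl | rfl⟩ := hσ
  exacts [hL a true, hL a false]

/-- Flip-free and even changes of the edges are possible with all corners fixed. -/
theorem mem_reachable_of_edge {h : Monomial 12 2} (hh : Monomial.twist 12 2 h = 1)
    (hs : Perm.sign h.right = 1) : (1, h) ∈ reachable := by
  let K : Subgroup (Monomial 12 2) := reachable.comap (MonoidHom.inr _ _)
  -- By `mem_reachable_of_corner`, an even action on the corners can be undone.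
  have hK : ∀ {g y}, (g, y) ∈ reachable → Perm.sign g.right = 1 → y ∈ K := by
    intro g y hx hg
    have := mul_mem
      (inv_mem (mem_reachable_of_corner (mem_ker_invariants.1 (reachable_le hx)).1 hg)) hx
    simpa [K] using this
  have hconj : ∀ a s, ∀ x ∈ K, edgeTurn a s * x * (edgeTurn a s)⁻¹ ∈ K := by
    intro a s x hx
    have := mul_mem (mul_mem (turn_mem_reachable a s) hx) (inv_mem (turn_mem_reachable a s))
    simpa [K] using this
  have hcyc : edgeCycleWord edgeTurn ∈ K :=
    hK (edgeCycleWord_mem turn_mem_reachable) sign_edgeCycleWord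
  have htw : edgeFlipWord edgeTurn ∈ K :=
    hK (edgeFlipWord_mem turn_mem_reachable) sign_edgeFlipWord
  rw [edgeFlipWord_edgeTurn] at htw
  change h ∈ K
  refine Monomial.mem_of_alternatingGroup_le (p := 6) (q := 10) (by norm_num)
    (fun x hx => (mem_ker_invariants.1 (reachable_le hx)).2.1) ?_ (by decide)
    htw hh hs
  refine alternatingGroup_le_of_blockStep _ ?_ ⟨_, hcyc, rfl⟩ edgeCycleWord_edgeTurn.1 0 _
    edgeCycleWord_edgeTurn.2
  have hL : ∀ a s, ∀ k ∈ K.map SemidirectProduct.rightHom,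
      (edgeTurn a s).right * k * (edgeTurn a s).right⁻¹ ∈
        K.map SemidirectProduct.rightHom := by
    rintro a s _ ⟨x, hx, rfl⟩
    exact ⟨_, hconj a s x hx, by simp⟩
  intro σ hσ
  simp only [List.mem_flatMap, List.mem_cons, List.not_mem_nil, or_false] at hσ
  obtain ⟨a, -, rfl | rfl⟩ := hσ
  exacts [hL a true, hL a false]

/-- The invariants are the only constraints on corners and edges. -/
theorem reachable_eq : reachable = invariants.ker := by
  have even : ∀ x ∈ invariants.ker, Perm.sign x.1.right = 1 → x ∈ reachable := by
    rintro ⟨g, h⟩ hx hg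
    obtain ⟨h1, h2, h3⟩ := mem_ker_invariants.1 hx
    have := mul_mem (mem_reachable_of_corner h1 hg) (mem_reachable_of_edge h2 (h3.symm.trans hg))
    simpa using this
  refine le_antisymm reachable_le fun x hx => ?_
  rcases Int.units_eq_one_or (Perm.sign x.1.right) with hs | hs
  · exact even x hx hs
  · have ht := turn_mem_reachable 0 true
    have := even _ (mul_mem hx (reachable_le ht)) (by simp [hs, cornerTurn_sign])
    exact (Subgroup.mul_mem_cancel_right _ ht).1 this

theorem invariants_surjective : Function.Surjective invariants := by
  rintro ⟨⟨a, b⟩, c⟩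
  obtain ⟨σ, hσ⟩ := Perm.sign_surjective (Fin 12) c
  refine ⟨(SemidirectProduct.inl (Pi.mulSingle 0 a),
    SemidirectProduct.inl (Pi.mulSingle 0 b) * SemidirectProduct.inr σ), ?_⟩
  have tw : ∀ k r (x : Multiplicative (ZMod r)),
      Monomial.twist (k + 1) r (SemidirectProduct.inl (Pi.mulSingle 0 x)) = x := by
    intro k r x
    simp [Monomial.twist_apply]
  have tr : Monomial.twist 12 2 (SemidirectProduct.inr σ) = 1 := by
    simp [Monomial.twist_apply]
  rw [invariants_apply, map_mul, tw, tw, tr]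
  simp [hσ]

theorem card_monomial (k r : ℕ) [NeZero r] : Nat.card (Monomial k r) = r ^ k * k.factorial := by
  rw [SemidirectProduct.card, Nat.card_perm, Nat.card_fun]
  simp [Nat.card_eq_fintype_card, ZMod.card]

theorem card_reachable :
    Nat.card reachable = Nat.factorial 8 * 3 ^ 7 * Nat.factorial 12 * 2 ^ 10 := by
  have h := invariants.ker.card_mul_index
  rw [Subgroup.index_ker, MonoidHom.range_eq_top.2 invariants_surjective, ← reachable_eq,
    Subgroup.card_top, Nat.card_prod, Nat.card_prod, Nat.card_prod, card_monomial,
    card_monomial] at h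
  have h3 : Nat.card (Multiplicative (ZMod 3)) = 3 := by simp
  have h2 : Nat.card (Multiplicative (ZMod 2)) = 2 := by simp
  have hu : Nat.card ℤˣ = 2 := by simp
  rw [h3, h2, hu] at h
  refine Nat.eq_of_mul_eq_mul_right (show 0 < 3 * 2 * 2 by norm_num) (h.trans ?_)
  ring

/-- The sign of the corner permutation is no constraint on the corners alone, since an odd
permutation of the edges can accompany it. -/
theorem map_fst_reachable : reachable.map (MonoidHom.fst _ _) = (Monomial.twist 8 3).ker := by
  refine le_antisymm ?_ fun g hg => ?_
  · rintro _ ⟨x, hx, rfl⟩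
    exact (mem_ker_invariants.1 (reachable_le hx)).1
  · obtain ⟨σ, hσ⟩ := Perm.sign_surjective (Fin 12) (Perm.sign g.right)
    refine ⟨(g, SemidirectProduct.inr σ), ?_, rfl⟩
    rw [SetLike.mem_coe, reachable_eq, mem_ker_invariants]
    exact ⟨hg, by simp [Monomial.twist_apply], by simp [hσ]⟩

theorem card_map_fst_reachable :
    Nat.card (reachable.map (MonoidHom.fst _ _)) = Nat.factorial 8 * 3 ^ 7 := by
  have hsurj : Function.Surjective (Monomial.twist 8 3) := fun x =>
    ⟨SemidirectProduct.inl (Pi.mulSingle 0 x), by simp [Monomial.twist_apply]⟩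
  have h := (Monomial.twist 8 3).ker.card_mul_index
  rw [Subgroup.index_ker, MonoidHom.range_eq_top.2 hsurj, ← map_fst_reachable,
    Subgroup.card_top, card_monomial] at h
  have h3 : Nat.card (Multiplicative (ZMod 3)) = 3 := by simp
  rw [h3] at h
  refine Nat.eq_of_mul_eq_mul_right (show 0 < 3 by norm_num) (h.trans ?_)
  ring

end Reachable

/-! ### The count -/

section Count

variable {m : ℕ}

/-- Inner layer turns move neither corners nor middle edges, so the action on these pieces is an
image of the group `reachable`. -/
theorem map_cornerEdge_turnGroup {D : Monomial 8 3 × Monomial 12 2 →* Perm Frame × Perm Frame}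
    (hD : ∀ a s, D (cornerTurn a s, edgeTurn a s) =
      cornerEdge m (layerTurn a (if s = true then Fin.last _ else 0))) :
    (turnGroup m).map (cornerEdge m) = reachable.map D := by
  refine le_antisymm (Subgroup.map_le_iff_le_comap.2 (turnGroup_le fun a l hl => ?_)) ?_
  · rw [Subgroup.mem_comap]
    by_cases h1 : l = Fin.last _
    · exact ⟨_, turn_mem_reachable a true, by rw [hD, h1]; rfl⟩
    by_cases h0 : l = 0
    · exact ⟨_, turn_mem_reachable a false, by rw [hD, h0]; rfl⟩
    simp only [cornerEdge_apply, layerTurn]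
    rw [layerFaces_corner_of_ne h0 h1,
      layerFaces_edge_of_ne h0 h1 hl, partialTurn_empty]
    exact one_mem _
  · rw [Subgroup.map_le_iff_le_comap, reachable, Subgroup.closure_le]
    rintro _ ⟨⟨a, s⟩, rfl⟩
    refine ⟨layerTurn a (if s = true then Fin.last _ else 0), layerTurn_mem a ?_, (hD a s).symm⟩
    cases s
    · exact zero_nonmid
    · exact last_nonmid

theorem card_cornerEdge_of_odd (hm : Odd m) : Nat.card ((turnGroup m).map (cornerEdge m)) =
    Nat.factorial 8 * 3 ^ 7 * Nat.factorial 12 * 2 ^ 10 := by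
  have hinj : Function.Injective (cornerAct.prodMap edgeAct) :=
    Prod.map_injective.2 ⟨cornerAct_injective, edgeAct_injective⟩
  rw [map_cornerEdge_turnGroup (D := cornerAct.prodMap edgeAct),
    ← Nat.card_congr (reachable.equivMapOfInjective _ hinj).toEquiv, card_reachable]
  intro a s
  change (cornerAct (cornerTurn a s), edgeAct (edgeTurn a s)) = _
  rw [cornerAct_cornerTurn, edgeAct_edgeTurn, cornerEdge_apply]
  cases s
  · simp [layerTurn, layerFaces_corner_zero, layerFaces_edge_zero hm, cornerFaces, edgeFaces]
  · simp [layerTurn, layerFaces_corner_last, layerFaces_edge_last hm, cornerFaces, edgeFaces]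

/-- For even `m` the edge is a second copy of the corner, and only the corners count. -/
theorem card_cornerEdge_of_even (hm : ¬ Odd m) :
    Nat.card ((turnGroup m).map (cornerEdge m)) = Nat.factorial 8 * 3 ^ 7 := by
  have hinj : Function.Injective (cornerAct.prod cornerAct) := fun x y h =>
    cornerAct_injective (congrArg Prod.fst h)
  rw [map_cornerEdge_turnGroup (D := (cornerAct.prod cornerAct).comp (MonoidHom.fst _ _)),
    ← Subgroup.map_map, ← Nat.card_congr (Subgroup.equivMapOfInjective _ _ hinj).toEquiv,
    card_map_fst_reachable]
  intro a s
  change (cornerAct (cornerTurn a s), cornerAct (cornerTurn a s)) = _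
  rw [cornerAct_cornerTurn, cornerEdge_apply, edgeCell_of_even hm]
  cases s
  · simp [layerTurn, layerFaces_corner_zero, cornerFaces]
  · simp [layerTurn, layerFaces_corner_last, cornerFaces]

/-- The colourings of a centre orbit by the six colours that arise from the solved one by a
permutation of the 24 places. -/
def Colouring : Type := {κ : Frame → Face // ∃ σ : Perm Frame, κ = fun ρ => (σ ρ).img (2, true)}

instance : Finite Colouring := Subtype.finite

/-- The stabilizer of the solved colouring permutes the four centres of each colour. -/
theorem card_colouring : Nat.card Colouring * 24 ^ 6 = Nat.factorial 24 := by
  let f : Frame → Face := fun ρ => ρ.img (2, true)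
  have horb : Nat.card Colouring = Nat.card (MulAction.orbit (Perm Frame)ᵈᵐᵃ f) := by
    refine Nat.card_congr (Equiv.subtypeEquivRight fun κ => ?_)
    constructor
    · rintro ⟨σ, rfl⟩
      exact ⟨DomMulAct.mk σ, rfl⟩
    · rintro ⟨σ, rfl⟩
      exact ⟨DomMulAct.mk.symm σ, rfl⟩
  have hstab : Nat.card (MulAction.stabilizer (Perm Frame)ᵈᵐᵃ f) = 24 ^ 6 := by
    have h := DomMulAct.stabilizer_card f
    have hfib : ∀ c, Fintype.card {ρ // f ρ = c} = 4 := by decide +kernel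
    simp only [hfib, Finset.prod_const, Finset.card_univ, Fintype.card_prod, Fintype.card_fin,
      Fintype.card_bool] at h
    rw [← Nat.card_eq_fintype_card] at h
    have e : {g : Perm Frame // f ∘ g = f} ≃ MulAction.stabilizer (Perm Frame)ᵈᵐᵃ f :=
      Equiv.subtypeEquiv DomMulAct.mk fun _ => Iff.rfl
    rw [← Nat.card_congr e, h]
    rfl
  have h := Nat.card_congr (MulAction.orbitProdStabilizerEquivGroup (Perm Frame)ᵈᵐᵃ f)
  rw [Nat.card_prod, hstab, ← horb] at h
  rw [h, ← Nat.card_congr (DomMulAct.mk (M := Perm Frame)), Nat.card_perm, Nat.card_fin]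

/-- The visible data of a configuration: the actual permutation for corners, edges and wings, but
only the colouring for the centres. -/
abbrev Look (m : ℕ) : Type :=
  (turnGroup m).map (cornerEdge m) × (Fin (m / 2) → Perm Frame) ×
    (Fin (m / 2) × Fin ((m + 1) / 2) → Colouring)

/-- The visible data of an element of the group generated by the layer turns. -/
def look (g : turnGroup m) : Look m :=
  (⟨cornerEdge m g, g, g.2, rfl⟩, wings m g,
    fun i => ⟨fun ρ => ((centers m g i)⁻¹ ρ).img (2, true), (centers m g i)⁻¹, rfl⟩)

/-- The wings are unconstrained by the corners and edges. The parity of each centre orbit is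
determined by the other pieces, but a swap of two centres of the same colour makes up for it. -/
theorem look_surjective : Function.Surjective (look (m := m)) := by
  rintro ⟨⟨_, g₀, hg₀, rfl⟩, π, κ⟩
  obtain ⟨g₁, hg₁, h₁⟩ : π * (wings m g₀)⁻¹ ∈ (fixCornersEdges m).map (wings m) := by
    rw [map_wings_eq_top]; trivial
  choose σ hσ using fun i => (κ i).2
  -- The rotations `0` and `3` carry the top sticker to the same face, so swapping these two places
  -- of the solved centre orbit is invisible.
  have heven : ∀ i, ∃ τ : Perm Frame, Perm.sign τ = 1 ∧
      ∀ ρ, (((τ * centers m (g₁ * g₀) i)⁻¹) ρ).img (2, true) = (κ i).1 ρ := by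
    intro i
    set x := centers m (g₁ * g₀) i
    rcases Int.units_eq_one_or (Perm.sign (x * σ i)) with hs | hs
    · refine ⟨(x * σ i)⁻¹, by rw [Perm.sign_inv, hs], fun ρ => ?_⟩
      rw [hσ i]
      simp
    · refine ⟨(x * swap 0 3 * σ i)⁻¹, ?_, fun ρ => ?_⟩
      · rw [map_mul] at hs
        rw [Perm.sign_inv, map_mul, map_mul, Perm.sign_swap (by decide), mul_neg_one, neg_mul, hs,
          neg_neg]
      · have hswap : ∀ ρ : Frame, (swap (0 : Frame) 3 ρ).img (2, true) = ρ.img (2, true) := by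
          decide +kernel
        rw [hσ i]
        simp [hswap]
  choose τ hτ hτκ using heven
  obtain ⟨g₂, hg₂, h₂⟩ := mem_map_centers_of_even hτ
  have hg₂' := Subgroup.mem_inf.1 hg₂
  have hg₁' := Subgroup.mem_inf.1 hg₁
  have hg₂'' := Subgroup.mem_inf.1 hg₂'.1
  refine ⟨⟨g₂ * (g₁ * g₀), mul_mem hg₂''.1 (mul_mem hg₁'.1 hg₀)⟩, ?_⟩
  refine Prod.ext (Subtype.ext ?_) (Prod.ext ?_ (funext fun i => Subtype.ext (funext fun ρ => ?_)))
  · change cornerEdge m (g₂ * (g₁ * g₀)) = cornerEdge m g₀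
    rw [map_mul, map_mul, MonoidHom.mem_ker.1 hg₂''.2, MonoidHom.mem_ker.1 hg₁'.2, one_mul, one_mul]
  · change wings m (g₂ * (g₁ * g₀)) = π
    rw [map_mul, map_mul, MonoidHom.mem_ker.1 hg₂'.2, h₁]
    simp
  · change ((centers m (g₂ * (g₁ * g₀)) i)⁻¹ ρ).img (2, true) = _
    rw [map_mul, Pi.mul_apply, h₂]
    exact hτκ i ρ

/-- Corners, edges and wings show two adjacent stickers, which determine a rotation; centres show
one sticker. -/
theorem appearance_eq_iff (w w' : Moves (m + 2)) :
    appearance (stickerPerm (m + 2) w) = appearance (stickerPerm (m + 2) w') ↔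
      look ⟨frameAction (m + 2) w, w, rfl⟩ = look ⟨frameAction (m + 2) w', w', rfl⟩ := by
  set g := frameAction (m + 2) w with hg
  set g' := frameAction (m + 2) w' with hg'
  have hlook : look ⟨g, w, rfl⟩ = look ⟨g', w', rfl⟩ ↔
      (g (cornerCell m) = g' (cornerCell m) ∧ g (edgeCell m) = g' (edgeCell m)) ∧
      (∀ j, g (wingCell j) = g' (wingCell j)) ∧
      ∀ i : Fin (m / 2) × Fin ((m + 1) / 2), ∀ ρ, ((g (centerCell i.1 i.2))⁻¹ ρ).img (2, true) =
        ((g' (centerCell i.1 i.2))⁻¹ ρ).img (2, true) := by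
    refine Prod.ext_iff.trans (and_congr ?_ (Prod.ext_iff.trans (and_congr ?_ ?_)))
    · exact Subtype.ext_iff.trans Prod.ext_iff
    · exact funext_iff
    · exact funext_iff.trans (forall_congr' fun i => Subtype.ext_iff.trans funext_iff)
  rw [hlook]
  have perm_eq : ∀ x y : Perm Frame,
      (∀ ρ, (x⁻¹ ρ).img (1, true) = (y⁻¹ ρ).img (1, true)) →
      (∀ ρ, (x⁻¹ ρ).img (2, true) = (y⁻¹ ρ).img (2, true)) → x = y := fun x y h1 h2 =>
    inv_injective (Equiv.ext fun ρ => Frame.img_ext _ _ (h1 ρ) (h2 ρ))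
  constructor
  · intro h
    have hof : ∀ p f, p.OnFace f → ∀ ρ, ((g p)⁻¹ ρ).img f = ((g' p)⁻¹ ρ).img f := by
      intro p f hp ρ
      rw [hg, hg', ← appearance_of w p f hp, ← appearance_of w' p f hp, h]
    refine ⟨⟨?_, ?_⟩, fun j => ?_, fun i => hof _ _ (onFace_two _ _)⟩
    · exact perm_eq _ _ (hof _ _ (onFace_one _ _)) (hof _ _ (onFace_two _ _))
    · exact perm_eq _ _ (hof _ _ (onFace_one _ _)) (hof _ _ (onFace_two _ _))
    · exact perm_eq _ _ (hof _ _ (onFace_one _ _)) (hof _ _ (onFace_two _ _))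
  · rintro ⟨⟨hc, he⟩, hw, hz⟩
    have hap : ∀ p f (hp : p.OnFace f), (∀ ρ, ((g p)⁻¹ ρ).img f = ((g' p)⁻¹ ρ).img f) → ∀ ρ,
        appearance (stickerPerm (m + 2) w) (Sticker.of p f hp ρ) =
          appearance (stickerPerm (m + 2) w') (Sticker.of p f hp ρ) := fun p f hp h ρ =>
      (appearance_of w p f hp ρ).trans ((h ρ).trans (appearance_of w' p f hp ρ).symm)
    refine funext fun s => Sticker.forall_of_representatives
      (P := fun s => appearance (stickerPerm (m + 2) w) s = appearance (stickerPerm (m + 2) w') s)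
      (hap _ _ _ fun ρ => by rw [hc]) (fun _ => hap _ _ _ fun ρ => by rw [he])
      (fun j => hap _ _ _ fun ρ => by rw [hw]) (fun j => hap _ _ _ fun ρ => by rw [hw])
      (fun j k => hap _ _ _ (hz (j, k))) (fun hm => hap _ _ _ fun ρ => ?_) s
    exact (img_faceCenter hm (inv_mem (⟨w, rfl⟩ : g ∈ turnGroup m)) ρ).trans
      (img_faceCenter hm (inv_mem (⟨w', rfl⟩ : g' ∈ turnGroup m)) ρ).symm

theorem card_sphys_eq_card_look : Nat.card (SPhys (m + 2)) = Nat.card (Look m) := by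
  let f : Moves (m + 2) → SPhys (m + 2) := fun w =>
    Quotient.mk (physSetoid (m + 2)) ⟨stickerPerm (m + 2) w, w, rfl⟩
  let g : Moves (m + 2) → Look m := fun w => look ⟨frameAction (m + 2) w, w, rfl⟩
  have hf : Function.Surjective f := by
    rintro ⟨_, w, rfl⟩
    exact ⟨w, rfl⟩
  have hg : Function.Surjective g := by
    intro x
    obtain ⟨⟨_, w, rfl⟩, hx⟩ := look_surjective x
    exact ⟨w, hx⟩
  have hker : Setoid.ker f = Setoid.ker g := by
    ext w w'
    rw [Setoid.ker_def, Setoid.ker_def, ← appearance_eq_iff]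
    exact Quotient.eq (r := physSetoid (m + 2))
  rw [← Nat.card_congr (Setoid.quotientKerEquivOfSurjective f hf), hker,
    Nat.card_congr (Setoid.quotientKerEquivOfSurjective g hg)]

theorem card_sphys : (Nat.card (SPhys (m + 2)) : ℚ) =
    Nat.card ((turnGroup m).map (cornerEdge m)) *
      (Nat.factorial 24 : ℚ) ^ (m / 2 + m / 2 * ((m + 1) / 2)) /
      ((24 : ℚ) ^ 6) ^ (m / 2 * ((m + 1) / 2)) := by
  have hcol : (Nat.card Colouring : ℚ) = (Nat.factorial 24 : ℚ) / (24 : ℚ) ^ 6 := by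
    rw [eq_div_iff (by positivity)]
    rw [← card_colouring]
    simp only [Nat.cast_mul, Nat.cast_pow, Nat.cast_ofNat]
  rw [card_sphys_eq_card_look, Nat.card_prod, Nat.card_prod, Nat.card_fun, Nat.card_fun,
    Nat.card_perm, Nat.card_fin, Nat.card_fin, Nat.card_prod, Nat.card_fin, Nat.card_fin]
  simp only [Nat.cast_mul, Nat.cast_pow]
  rw [hcol, div_pow, pow_add]
  ring

end Count

end RubikCube

theorem mainTheorem6 (n : ℕ) (hn : 2 ≤ n) :
    (Odd n →
      (Nat.card (RubikCube.SPhys n) : ℚ) =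
        (Nat.factorial 8 : ℚ) * 3 ^ 7 * (Nat.factorial 12 : ℚ) * 2 ^ 10 *
            (Nat.factorial 24 : ℚ) ^ ((n - 3) * (n + 1) / 4) /
          ((24 : ℚ) ^ 6) ^ ((n - 3) * (n - 1) / 4)) ∧
    (Even n →
      (Nat.card (RubikCube.SPhys n) : ℚ) =
        (Nat.factorial 8 : ℚ) * 3 ^ 7 *
            (Nat.factorial 24 : ℚ) ^ (n * (n - 2) / 4) /
          ((24 : ℚ) ^ 6) ^ ((n - 2) ^ 2 / 4)) := by
  constructor
  · rintro ⟨r, rfl⟩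
    obtain ⟨t, rfl⟩ : ∃ t, r = t + 1 := ⟨r - 1, by omega⟩
    have h := RubikCube.card_sphys (m := 2 * t + 1)
    rw [RubikCube.card_cornerEdge_of_odd ⟨t, rfl⟩, show (2 * t + 1) / 2 = t by omega,
      show (2 * t + 1 + 1) / 2 = t + 1 by omega] at h
    have e1 : (2 * (t + 1) + 1 - 3) * (2 * (t + 1) + 1 + 1) / 4 = t + t * (t + 1) := by
      rw [show 2 * (t + 1) + 1 - 3 = 2 * t by omega]
      exact Nat.div_eq_of_eq_mul_right (by norm_num) (by ring)
    have e2 : (2 * (t + 1) + 1 - 3) * (2 * (t + 1) + 1 - 1) / 4 = t * (t + 1) := by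
      rw [show 2 * (t + 1) + 1 - 3 = 2 * t by omega,
        show 2 * (t + 1) + 1 - 1 = 2 * (t + 1) by omega]
      exact Nat.div_eq_of_eq_mul_right (by norm_num) (by ring)
    rw [e1, e2]
    refine Eq.trans h ?_
    push_cast
    rfl
  · rintro ⟨r, rfl⟩
    obtain ⟨t, rfl⟩ : ∃ t, r = t + 1 := ⟨r - 1, by omega⟩
    have h := RubikCube.card_sphys (m := 2 * t)
    rw [RubikCube.card_cornerEdge_of_even (by simp), show 2 * t / 2 = t by omega,
      show (2 * t + 1) / 2 = t by omega] at h
    have e1 : (t + 1 + (t + 1)) * (t + 1 + (t + 1) - 2) / 4 = t + t * t := by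
      rw [show t + 1 + (t + 1) - 2 = 2 * t by omega]
      exact Nat.div_eq_of_eq_mul_right (by norm_num) (by ring)
    have e2 : (t + 1 + (t + 1) - 2) ^ 2 / 4 = t * t := by
      rw [show t + 1 + (t + 1) - 2 = 2 * t by omega]
      exact Nat.div_eq_of_eq_mul_right (by norm_num) (by ring)
    rw [e1, e2, show t + 1 + (t + 1) = 2 * t + 2 by ring, h]
    push_cast
    rfl
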